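/- Let $\gamma=(1+\sqrt5)/2$. Call a real number $\xi$ *extremal* if it is neither rational nor quadratic irrational and if there is a constant $c_0>0$ such that, for every real number $X\ge 1$, the inequalities $$|x_0|\le X,\qquad |x_0\xi-x_1|\le c_0X^{-1/\gamma},\qquad |x_0\xi^2-x_2|\le c_0X^{-1/\gamma}$$ have a non-zero solution $(x_0,x_1,x_2)\in\mathbf Z^3$. The height $H(\alpha)$ of an algebraic number $\alpha$ is the maximum of the absolute values of the coefficients of its irreducible polynomial over $\mathbf Z$. **Theorem 1.5.** Let $\xi$ be an extremal real number. There exists a constant $c>0$ (depending only on $\xi$) such that, for every algebraic integer $\alpha\in\mathbf C$ of degree at most $3$ over $\mathbf Q$, $$|\xi-\alpha|\ge c\,H(\alpha)^{-\gamma^2-1}.$$ -/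

import Mathlib

/-- A quadratic irrational number: a real number that is algebraic of degree exactly `2`
over `ℚ`. -/
def IsQuadraticIrrational (ξ : ℝ) : Prop :=
  IsAlgebraic ℚ ξ ∧ (minpoly ℚ ξ).natDegree = 2

/-- A real number `ξ` is extremal if it is neither rational nor quadratic irrational and if there
is a constant `c > 0` such that, for every real number `X ≥ 1`, the inequalities
`|x₀| ≤ X`, `|x₀ ξ - x₁| ≤ c X ^ (-1/γ)`, `|x₀ ξ² - x₂| ≤ c X ^ (-1/γ)` have a non-zero solution
`(x₀, x₁, x₂) ∈ ℤ³`, where `γ` is the golden ratio. -/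
def IsExtremal (ξ : ℝ) : Prop :=
  Irrational ξ ∧ ¬ IsQuadraticIrrational ξ ∧
    ∃ c : ℝ, 0 < c ∧ ∀ X : ℝ, 1 ≤ X →
      ∃ x₀ x₁ x₂ : ℤ, (x₀, x₁, x₂) ≠ (0, 0, 0) ∧
        |(x₀ : ℝ)| ≤ X ∧
        |(x₀ : ℝ) * ξ - x₁| ≤ c * X ^ (-1 / Real.goldenRatio) ∧
        |(x₀ : ℝ) * ξ ^ 2 - x₂| ≤ c * X ^ (-1 / Real.goldenRatio)

/-- The height of an algebraic integer `α`: the maximum of the absolute values of the coefficients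
of its irreducible polynomial over `ℤ`. For an algebraic integer this polynomial is, up to sign,
its monic minimal polynomial over `ℤ`; see `algIntHeight_eq`. -/
noncomputable def algIntHeight (α : ℂ) : ℝ := (minpoly ℤ α).supNorm

/-- The height of an algebraic integer may be computed from any irreducible polynomial of `ℤ[T]`
which vanishes at it. -/
theorem algIntHeight_eq {α : ℂ} (hα : IsIntegral ℤ α) {P : Polynomial ℤ} (hP : Irreducible P)
    (h0 : Polynomial.aeval α P = 0) : algIntHeight α = P.supNorm := by
  have hd : minpoly ℤ α ∣ P := minpoly.isIntegrallyClosed_dvd hα h0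
  have ha : Associated (minpoly ℤ α) P :=
    (minpoly.irreducible hα).associated_of_dvd hP hd
  obtain ⟨u, hu⟩ := ha
  obtain ⟨r, hr, hru⟩ := Polynomial.isUnit_iff.1 u.isUnit
  rw [← hu, ← hru, algIntHeight]
  rcases Int.isUnit_iff.1 hr with rfl | rfl
  · simp
  · rw [Polynomial.supNorm_def', Polynomial.supNorm_def']
    simp

/-!
Write `γ` for the golden ratio. The height exponent comes from a lower bound
`|P(ξ)| ≥ c H(P) ^ (-γ²)` for all monic cubic integer polynomials `P`
(`IsExtremal.exists_le_abs_cubic`). The theorem follows, because an algebraic integer `α` of degree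
at most `3` is a root of such a `P` of height at most `H(α)`, and
`|P(ξ)| = |P(ξ) - P(α)| ≪ H(α) |ξ - α|` when `α` is near `ξ`.

The extremal number enters through a sequence of integer points `y k`, close to the line spanned by
`(1, ξ, ξ²)`, with sizes `Y k` such that `Y (k + 1)` is comparable to `Y k ^ γ`, with errors
`≪ 1 / Y k`, and with `det (y k, y (k + 1), y (k + 2))` a bounded non-zero integer
(`IsExtremal.exists_isExtremalSequence`). If `P(ξ)` is small and `(w₀, w₁, w₂) = y (k + 2)`, then
`P` yields an integer `w₃` close to `w₀ ξ³`, so `(w₁, w₂, w₃)` is close to `ξ • y (k + 2)`.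
Replacing `y (k + 2)` by it in the determinant gives an integer close to `ξ` times a bounded
non-zero integer. Since `ξ` is irrational this cannot be too close, which gives
`1 ≪ Y (k + 1) ^ 2 |P(ξ)| + H(P) / Y k ^ 2`
(`IsExtremalSequence.le_of_forall_le_abs_sub`). The least `k` for which `Y k ^ 2` exceeds a large
multiple of `H(P)` then yields the lower bound.

The points `y k` are found among the minimal points `x i` of Davenport and Schmidt, with sizes `X i`
and errors `L i ≪ X (i + 1) ^ (-1 / γ)`. Their discriminants are eventually non-zero
(`disc_ne_zero`), whence `X (i + 1) ≪ X i ^ γ`. Because `ξ` is not quadratic, three consecutive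
points are independent infinitely often; the middle points of these triples are the `y k`.
The determinant gives `X (i + 1) ≫ X i ^ γ` for a middle point `x i`. If `x j` is the next middle
point, then `x i, x (i + 1)` and `x (j - 1), x j` lie in one plane, of whose lattice consecutive
minimal points form a basis (`IsNextMinimal.exists_eq_combination`). Comparison of the two areas
shows that `X j` and `X (i + 1)` are comparable
(`IsMinimalSequence.rpow_fst_le_of_consecutive`).
-/

/-! ### Minimal points -/

/-- The quality `max |x₀ ξ - x₁| |x₀ ξ² - x₂|` of an integer point `(x₀, x₁, x₂)` as a
simultaneous approximation of `(1, ξ, ξ²)`. -/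
noncomputable def approxErr (ξ : ℝ) (p : ℤ × ℤ × ℤ) : ℝ :=
  max |(p.1 : ℝ) * ξ - p.2.1| |(p.1 : ℝ) * ξ ^ 2 - p.2.2|

/-- The determinant of three integer points. -/
def det3 (p q r : ℤ × ℤ × ℤ) : ℤ :=
  p.1 * (q.2.1 * r.2.2 - q.2.2 * r.2.1) - q.1 * (p.2.1 * r.2.2 - p.2.2 * r.2.1)
    + r.1 * (p.2.1 * q.2.2 - p.2.2 * q.2.1)

/-- A minimal point: no non-zero integer point with at most the same first coordinate (in absolute
value) approximates `(1, ξ, ξ²)` better. Points are measured by `|p.1|` alone. -/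
def IsMinimalPoint (ξ : ℝ) (p : ℤ × ℤ × ℤ) : Prop :=
  p ≠ 0 ∧ ∀ z : ℤ × ℤ × ℤ, z ≠ 0 → |z.1| ≤ |p.1| → approxErr ξ p ≤ approxErr ξ z

/-- `q` is a minimal point that follows the minimal point `p`: it improves on `p`, and no
non-zero point with a smaller first coordinate does. -/
structure IsNextMinimal (ξ : ℝ) (p q : ℤ × ℤ × ℤ) : Prop where
  left : IsMinimalPoint ξ p
  right : IsMinimalPoint ξ q
  err_lt : approxErr ξ q < approxErr ξ p
  le_err : ∀ z : ℤ × ℤ × ℤ, z ≠ 0 → |z.1| < |q.1| → approxErr ξ p ≤ approxErr ξ z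

theorem abs_fst_mul_sub_le (ξ : ℝ) (p : ℤ × ℤ × ℤ) :
    |(p.1 : ℝ) * ξ - p.2.1| ≤ approxErr ξ p := le_max_left _ _

theorem abs_fst_mul_sq_sub_le (ξ : ℝ) (p : ℤ × ℤ × ℤ) :
    |(p.1 : ℝ) * ξ ^ 2 - p.2.2| ≤ approxErr ξ p := le_max_right _ _

theorem approxErr_nonneg (ξ : ℝ) (p : ℤ × ℤ × ℤ) : 0 ≤ approxErr ξ p :=
  (abs_nonneg _).trans (abs_fst_mul_sub_le ξ p)

theorem approxErr_pos {ξ : ℝ} (hξ : Irrational ξ) {p : ℤ × ℤ × ℤ} (hp : p ≠ 0) :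
    0 < approxErr ξ p := by
  refine (approxErr_nonneg ξ p).lt_of_ne fun h => hp ?_
  have h1 := abs_fst_mul_sub_le ξ p
  have h2 := abs_fst_mul_sq_sub_le ξ p
  rw [← h, abs_nonpos_iff, sub_eq_zero] at h1 h2
  have h0 : p.1 = 0 := by
    by_contra h0
    exact (hξ.intCast_mul h0).ne_int p.2.1 h1
  simp only [h0, Int.cast_zero, zero_mul] at h1 h2
  ext
  · exact h0
  · exact_mod_cast h1.symm
  · exact_mod_cast h2.symm

theorem approxErr_smul (ξ : ℝ) (n : ℤ) (p : ℤ × ℤ × ℤ) :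
    approxErr ξ (n • p) = |(n : ℝ)| * approxErr ξ p := by
  simp only [approxErr, Prod.smul_fst, Prod.smul_snd, smul_eq_mul, Int.cast_mul]
  rw [mul_max_of_nonneg _ _ (abs_nonneg _), ← abs_mul, ← abs_mul]
  congr 2 <;> ring

/-- Only finitely many integer points have bounded first coordinate and bounded error. -/
theorem finite_setOf_approxErr_le (ξ : ℝ) (n : ℤ) (c : ℝ) :
    {p : ℤ × ℤ × ℤ | |p.1| ≤ n ∧ approxErr ξ p ≤ c}.Finite := by
  set M : ℝ := |(n : ℝ)| * |ξ| + |(n : ℝ)| * |ξ| ^ 2 + |c| with hM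
  have hbox : ((Set.Icc (-n) n) ×ˢ ((Set.Icc (-⌈M⌉) ⌈M⌉) ×ˢ (Set.Icc (-⌈M⌉) ⌈M⌉))).Finite :=
    (Set.finite_Icc _ _).prod ((Set.finite_Icc _ _).prod (Set.finite_Icc _ _))
  refine hbox.subset ?_
  rintro p ⟨hp, hc⟩
  have hp' : |(p.1 : ℝ)| ≤ |(n : ℝ)| := by exact_mod_cast hp.trans (le_abs_self n)
  have hb : ∀ (t : ℤ) (θ : ℝ), |(p.1 : ℝ) * θ - t| ≤ approxErr ξ p →
      |(n : ℝ)| * |θ| + |c| ≤ M → t ∈ Set.Icc (-⌈M⌉) ⌈M⌉ := by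
    intro t θ ht hθ
    have h1 : |(t : ℝ)| ≤ M := by
      have h2 : (t : ℝ) = p.1 * θ - (p.1 * θ - t) := by ring
      rw [h2]
      refine (abs_sub _ _).trans (le_trans ?_ hθ)
      rw [abs_mul]
      exact add_le_add (by gcongr) ((ht.trans hc).trans (le_abs_self c))
    have h3 : |(t : ℝ)| ≤ (⌈M⌉ : ℝ) := h1.trans (Int.le_ceil M)
    have h4 : |t| ≤ ⌈M⌉ := by exact_mod_cast h3
    exact abs_le.1 h4
  refine ⟨abs_le.1 hp, hb _ ξ (abs_fst_mul_sub_le ξ p) ?_,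
    hb _ (ξ ^ 2) (abs_fst_mul_sq_sub_le ξ p) ?_⟩
  · have : 0 ≤ |(n : ℝ)| * |ξ| ^ 2 := by positivity
    linarith
  · have : 0 ≤ |(n : ℝ)| * |ξ| := by positivity
    rw [abs_pow]
    linarith

theorem isMinimalPoint_start (ξ : ℝ) : IsMinimalPoint ξ (0, 1, 0) := by
  refine ⟨by simp, fun z hz h => ?_⟩
  have h0 : z.1 = 0 := by simpa using h
  have h1 : approxErr ξ (0, 1, 0) = 1 := by simp [approxErr]
  rw [h1]
  simp only [approxErr, h0, Int.cast_zero, zero_mul, zero_sub, abs_neg, le_max_iff]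
  by_cases h2 : z.2.1 = 0
  · right
    have h3 : z.2.2 ≠ 0 := fun h3 => hz (by ext <;> assumption)
    exact_mod_cast Int.one_le_abs h3
  · left
    exact_mod_cast Int.one_le_abs h2

/-- Every minimal point is followed by another one as soon as there are points that improve
on it. -/
theorem IsMinimalPoint.exists_next {ξ : ℝ} {p : ℤ × ℤ × ℤ} (hp : IsMinimalPoint ξ p)
    (h : ∃ z : ℤ × ℤ × ℤ, z ≠ 0 ∧ approxErr ξ z < approxErr ξ p) :
    ∃ q, IsNextMinimal ξ p q := by
  classical
  have hex : ∃ n : ℕ, ∃ z : ℤ × ℤ × ℤ, z ≠ 0 ∧ approxErr ξ z < approxErr ξ p ∧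
      z.1.natAbs = n := by
    obtain ⟨z, hz, hlt⟩ := h
    exact ⟨_, z, hz, hlt, rfl⟩
  obtain ⟨z, hz, hlt, hn⟩ := Nat.find_spec hex
  have hmin := fun m => Nat.find_min hex (m := m)
  set n := Nat.find hex
  have hzn : |z.1| = (n : ℤ) := by rw [← hn, Int.natCast_natAbs]
  -- a best point among those whose first coordinate is at most the least improving one
  obtain ⟨q, ⟨⟨hqn, hqz⟩, hq0⟩, hq⟩ := Set.exists_min_image
    ({q : ℤ × ℤ × ℤ | |q.1| ≤ (n : ℤ) ∧ approxErr ξ q ≤ approxErr ξ z} ∩ {q | q ≠ 0})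
    (approxErr ξ) ((finite_setOf_approxErr_le ξ n _).inter_of_left _) ⟨z, ⟨hzn.le, le_rfl⟩, hz⟩
  refine ⟨q, hp, ⟨hq0, fun w hw hwq => ?_⟩, hqz.trans_lt hlt, fun w hw hwq => ?_⟩
  · rcases le_total (approxErr ξ w) (approxErr ξ z) with h | h
    · exact hq w ⟨⟨hwq.trans hqn, h⟩, hw⟩
    · exact hqz.trans h
  · by_contra hcon
    have hw1 := Int.natCast_natAbs w.1
    exact hmin w.1.natAbs (by omega) ⟨w, hw, not_le.1 hcon, rfl⟩

/-! ### Lattices spanned by consecutive minimal points -/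

section Consecutive

variable {ξ : ℝ} {p q r : ℤ × ℤ × ℤ}

theorem IsNextMinimal.fst_lt (h : IsNextMinimal ξ p q) : |p.1| < |q.1| := by
  by_contra hcon
  exact (h.left.2 q h.right.1 (not_lt.1 hcon)).not_gt h.err_lt

/-- Consecutive minimal points are linearly independent; more precisely one of the two minors that
involve the first coordinate does not vanish. -/
theorem IsNextMinimal.minor_ne_zero (h : IsNextMinimal ξ p q) (hp : p.1 ≠ 0) :
    p.1 * q.2.1 - p.2.1 * q.1 ≠ 0 ∨ p.1 * q.2.2 - p.2.2 * q.1 ≠ 0 := by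
  by_contra! hcon
  obtain ⟨h1, h2⟩ := hcon
  have h1' : (p.1 : ℝ) * q.2.1 = p.2.1 * q.1 := by exact_mod_cast sub_eq_zero.1 h1
  have h2' : (p.1 : ℝ) * q.2.2 = p.2.2 * q.1 := by exact_mod_cast sub_eq_zero.1 h2
  have hmul : p.1 • q = q.1 • p := by
    ext
    · simp [mul_comm]
    · simp; linarith
    · simp; linarith
  have key : |(p.1 : ℝ)| * approxErr ξ q = |(q.1 : ℝ)| * approxErr ξ p := by
    rw [← approxErr_smul, ← approxErr_smul, hmul]
  have hlt : |(p.1 : ℝ)| < |(q.1 : ℝ)| := by exact_mod_cast h.fst_lt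
  have hp' : 0 < |(p.1 : ℝ)| := by positivity
  have := h.err_lt
  have := approxErr_nonneg ξ q
  nlinarith

/-- Consecutive minimal points form a basis of the lattice of integer points of the plane which
they span. -/
theorem IsNextMinimal.exists_eq_combination (h : IsNextMinimal ξ p q) (hp : p.1 ≠ 0)
    (hD : det3 r p q = 0) : ∃ a b : ℤ, r = a • p + b • q := by
  have hDR : (r.1 : ℝ) * (p.2.1 * q.2.2 - p.2.2 * q.2.1) - p.1 * (r.2.1 * q.2.2 - r.2.2 * q.2.1)
      + q.1 * (r.2.1 * p.2.2 - r.2.2 * p.2.1) = 0 := by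
    have : ((det3 r p q : ℤ) : ℝ) = 0 := by rw [hD]; simp
    simpa [det3] using this
  obtain ⟨α, β, h0, h1, h2⟩ : ∃ α β : ℝ, (r.1 : ℝ) = α * p.1 + β * q.1 ∧
      (r.2.1 : ℝ) = α * p.2.1 + β * q.2.1 ∧ (r.2.2 : ℝ) = α * p.2.2 + β * q.2.2 := by
    rcases h.minor_ne_zero hp with hm | hm
    · have hm' : (p.1 : ℝ) * q.2.1 - p.2.1 * q.1 ≠ 0 := by exact_mod_cast hm
      refine ⟨(r.1 * q.2.1 - r.2.1 * q.1) / (p.1 * q.2.1 - p.2.1 * q.1),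
        (p.1 * r.2.1 - p.2.1 * r.1) / (p.1 * q.2.1 - p.2.1 * q.1), ?_, ?_, ?_⟩
      · rw [div_mul_eq_mul_div, div_mul_eq_mul_div, ← add_div, eq_div_iff hm']; ring
      · rw [div_mul_eq_mul_div, div_mul_eq_mul_div, ← add_div, eq_div_iff hm']; ring
      · rw [div_mul_eq_mul_div, div_mul_eq_mul_div, ← add_div, eq_div_iff hm']
        linear_combination hDR
    · have hm' : (p.1 : ℝ) * q.2.2 - p.2.2 * q.1 ≠ 0 := by exact_mod_cast hm
      refine ⟨(r.1 * q.2.2 - r.2.2 * q.1) / (p.1 * q.2.2 - p.2.2 * q.1),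
        (p.1 * r.2.2 - p.2.2 * r.1) / (p.1 * q.2.2 - p.2.2 * q.1), ?_, ?_, ?_⟩
      · rw [div_mul_eq_mul_div, div_mul_eq_mul_div, ← add_div, eq_div_iff hm']; ring
      · rw [div_mul_eq_mul_div, div_mul_eq_mul_div, ← add_div, eq_div_iff hm']
        linear_combination -hDR
      · rw [div_mul_eq_mul_div, div_mul_eq_mul_div, ← add_div, eq_div_iff hm']; ring
  refine ⟨round α, round β, ?_⟩
  by_contra hne
  set z := r - (round α • p + round β • q) with hz
  have hz0 : z ≠ 0 := sub_ne_zero.2 hne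
  have hα := abs_sub_round α
  have hβ := abs_sub_round β
  set s := α - round α with hs
  set t := β - round β with ht
  have e0 : (z.1 : ℝ) = s * p.1 + t * q.1 := by
    simp only [hz, Prod.fst_sub, Prod.fst_add, Prod.smul_fst, smul_eq_mul]
    push_cast; rw [h0, hs, ht]; ring
  have e1 : (z.2.1 : ℝ) = s * p.2.1 + t * q.2.1 := by
    simp only [hz, Prod.fst_sub, Prod.fst_add, Prod.smul_fst, smul_eq_mul, Prod.snd_sub,
      Prod.snd_add, Prod.smul_snd]
    push_cast; rw [h1, hs, ht]; ring
  have e2 : (z.2.2 : ℝ) = s * p.2.2 + t * q.2.2 := by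
    simp only [hz, smul_eq_mul, Prod.snd_sub, Prod.snd_add, Prod.smul_snd]
    push_cast; rw [h2, hs, ht]; ring
  have comb : ∀ u v A B : ℝ, |u| ≤ A → |v| ≤ B → |s * u + t * v| ≤ 1 / 2 * (A + B) := by
    intro u v A B hu hv
    refine (abs_add_le _ _).trans ?_
    rw [abs_mul, abs_mul, mul_add]
    gcongr
  have hlt : |(p.1 : ℝ)| < |(q.1 : ℝ)| := by exact_mod_cast h.fst_lt
  have hzq : |(z.1 : ℝ)| < |(q.1 : ℝ)| := by
    rw [e0]
    have := comb p.1 q.1 _ _ le_rfl le_rfl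
    linarith
  have hzL : approxErr ξ z ≤ 1 / 2 * (approxErr ξ p + approxErr ξ q) := by
    refine max_le ?_ ?_
    · have := comb _ _ _ _ (abs_fst_mul_sub_le ξ p) (abs_fst_mul_sub_le ξ q)
      rw [e0, e1]
      refine le_trans (le_of_eq ?_) this
      congr 1; ring
    · have := comb _ _ _ _ (abs_fst_mul_sq_sub_le ξ p) (abs_fst_mul_sq_sub_le ξ q)
      rw [e0, e2]
      refine le_trans (le_of_eq ?_) this
      congr 1; ring
  have := h.le_err z hz0 (by exact_mod_cast hzq)
  have := h.err_lt
  linarith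

end Consecutive

/-! ### Estimates for determinants, and integer relations of degree two -/

/-- Expanding a determinant along the first coordinates, when the other coordinates are small. -/
theorem abs_det_le {a0 a1 a2 b0 b1 b2 c0 c1 c2 A B C α β γ : ℝ}
    (ha0 : |a0| ≤ A) (hb0 : |b0| ≤ B) (hc0 : |c0| ≤ C) (ha1 : |a1| ≤ α) (ha2 : |a2| ≤ α)
    (hb1 : |b1| ≤ β) (hb2 : |b2| ≤ β) (hc1 : |c1| ≤ γ) (hc2 : |c2| ≤ γ) :
    |a0 * (b1 * c2 - b2 * c1) - b0 * (a1 * c2 - a2 * c1) + c0 * (a1 * b2 - a2 * b1)|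
      ≤ 2 * (A * (β * γ) + B * (α * γ) + C * (α * β)) := by
  have minor : ∀ u1 u2 v1 v2 U V : ℝ, |u1| ≤ U → |u2| ≤ U → |v1| ≤ V → |v2| ≤ V →
      |u1 * v2 - u2 * v1| ≤ 2 * (U * V) := by
    intro u1 u2 v1 v2 U V h1 h2 h3 h4
    have hU : 0 ≤ U := (abs_nonneg _).trans h1
    refine (abs_sub _ _).trans ?_
    rw [abs_mul, abs_mul, two_mul]
    gcongr
  have hA : 0 ≤ A := (abs_nonneg _).trans ha0
  have hB : 0 ≤ B := (abs_nonneg _).trans hb0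
  have hC : 0 ≤ C := (abs_nonneg _).trans hc0
  calc _ ≤ |a0| * |b1 * c2 - b2 * c1| + |b0| * |a1 * c2 - a2 * c1|
        + |c0| * |a1 * b2 - a2 * b1| := by
        rw [← abs_mul, ← abs_mul, ← abs_mul]
        exact (abs_add_le _ _).trans (by gcongr; exact abs_sub _ _)
    _ ≤ A * (2 * (β * γ)) + B * (2 * (α * γ)) + C * (2 * (α * β)) := by
        gcongr
        · exact minor _ _ _ _ _ _ hb1 hb2 hc1 hc2
        · exact minor _ _ _ _ _ _ ha1 ha2 hc1 hc2
        · exact minor _ _ _ _ _ _ ha1 ha2 hb1 hb2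
    _ = _ := by ring

theorem abs_det3_le (ξ : ℝ) (p q r : ℤ × ℤ × ℤ) :
    |(det3 p q r : ℝ)| ≤ 2 * (|(p.1 : ℝ)| * (approxErr ξ q * approxErr ξ r)
      + |(q.1 : ℝ)| * (approxErr ξ p * approxErr ξ r)
      + |(r.1 : ℝ)| * (approxErr ξ p * approxErr ξ q)) := by
  have := abs_det_le (a0 := p.1) (b0 := q.1) (c0 := r.1) le_rfl le_rfl le_rfl
    (abs_fst_mul_sub_le ξ p) (abs_fst_mul_sq_sub_le ξ p) (abs_fst_mul_sub_le ξ q)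
    (abs_fst_mul_sq_sub_le ξ q) (abs_fst_mul_sub_le ξ r) (abs_fst_mul_sq_sub_le ξ r)
  convert this using 2
  simp only [det3]
  push_cast
  ring

/-- The determinant of three minimal points, ordered by size, is controlled by the dominant term
of its expansion. -/
theorem abs_det3_le_of_le {ξ : ℝ} {p q r : ℤ × ℤ × ℤ} (hpr : |p.1| ≤ |r.1|) (hqr : |q.1| ≤ |r.1|)
    (hp : approxErr ξ r ≤ approxErr ξ p) (hq : approxErr ξ r ≤ approxErr ξ q) :
    |(det3 p q r : ℝ)| ≤ 6 * |(r.1 : ℝ)| * approxErr ξ p * approxErr ξ q := by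
  refine (abs_det3_le ξ p q r).trans ?_
  have hpr' : |(p.1 : ℝ)| ≤ |(r.1 : ℝ)| := by exact_mod_cast hpr
  have hqr' : |(q.1 : ℝ)| ≤ |(r.1 : ℝ)| := by exact_mod_cast hqr
  have n1 := approxErr_nonneg ξ p
  have n2 := approxErr_nonneg ξ q
  have n3 := approxErr_nonneg ξ r
  calc _ ≤ 2 * (|(r.1 : ℝ)| * (approxErr ξ q * approxErr ξ p)
      + |(r.1 : ℝ)| * (approxErr ξ p * approxErr ξ q)
      + |(r.1 : ℝ)| * (approxErr ξ p * approxErr ξ q)) := by gcongr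
    _ = _ := by ring

/-- An irrational number which satisfies a non-trivial integer relation of degree at most `2` is a
quadratic irrational. -/
theorem isQuadraticIrrational_of_relation {ξ : ℝ} (hξ : Irrational ξ) {a b c : ℤ}
    (hne : (a, b, c) ≠ 0) (h : (a : ℝ) + b * ξ + c * ξ ^ 2 = 0) : IsQuadraticIrrational ξ := by
  open Polynomial in
  set P : ℚ[X] := C (c : ℚ) * X ^ 2 + C (b : ℚ) * X + C (a : ℚ) with hP
  have hP0 : P ≠ 0 := by
    intro h0
    apply hne
    have e0 : P.coeff 0 = 0 := by rw [h0]; simp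
    have e1 : P.coeff 1 = 0 := by rw [h0]; simp
    have e2 : P.coeff 2 = 0 := by rw [h0]; simp
    simp only [hP, Polynomial.coeff_add, Polynomial.coeff_C_mul, Polynomial.coeff_X_pow,
      Polynomial.coeff_X, Polynomial.coeff_C] at e0 e1 e2
    simp only [OfNat.zero_ne_ofNat, if_false, OfNat.one_ne_ofNat, one_ne_zero,
      OfNat.ofNat_ne_zero, if_true, mul_zero, mul_one, add_zero, zero_add,
      Int.cast_eq_zero] at e0 e1 e2
    simp [e0, e1, e2]
  have hPξ : Polynomial.aeval ξ P = 0 := by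
    simp only [hP, map_add, map_mul, Polynomial.aeval_X, Polynomial.aeval_C, map_pow]
    simp
    linarith
  have halg : IsAlgebraic ℚ ξ := ⟨P, hP0, hPξ⟩
  refine ⟨halg, ?_⟩
  have hle : (minpoly ℚ ξ).natDegree ≤ 2 :=
    (Polynomial.natDegree_le_of_dvd (minpoly.dvd ℚ ξ hPξ) hP0).trans
      Polynomial.natDegree_quadratic_le
  have hpos : 0 < (minpoly ℚ ξ).natDegree := minpoly.natDegree_pos halg.isIntegral
  have h1 : (minpoly ℚ ξ).natDegree ≠ 1 := by
    intro h1
    obtain ⟨x, hx⟩ := minpoly.natDegree_eq_one_iff.1 h1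
    exact hξ ⟨x, by simpa using hx⟩
  omega

/-! ### Arithmetic of the exponent -/

open Real in
theorem inv_goldenRatio_sq : goldenRatio⁻¹ ^ 2 = 1 - goldenRatio⁻¹ := by
  have h := goldenRatio_sq
  have h1 : goldenRatio⁻¹ * goldenRatio = 1 := inv_mul_cancel₀ goldenRatio_ne_zero
  linear_combination -goldenRatio⁻¹ ^ 2 * h
    + (goldenRatio⁻¹ * goldenRatio + 1 - goldenRatio⁻¹) * h1

open Real in
theorem inv_goldenRatio_pos : 0 < goldenRatio⁻¹ := inv_pos.2 goldenRatio_pos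

open Real in
theorem inv_goldenRatio_lt_one : goldenRatio⁻¹ < 1 := inv_lt_one_of_one_lt₀ one_lt_goldenRatio

open Real in
theorem half_lt_inv_goldenRatio : 1 / 2 < goldenRatio⁻¹ := by
  rw [one_div]
  exact inv_strictAnti₀ goldenRatio_pos goldenRatio_lt_two

theorem IsMinimalPoint.approxErr_le_one {ξ : ℝ} {p : ℤ × ℤ × ℤ} (h : IsMinimalPoint ξ p) :
    approxErr ξ p ≤ 1 := by
  have := h.2 (0, 1, 0) (by simp) (by simp)
  simpa [approxErr] using this

/-! ### Discriminants of minimal points -/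

/-- The discriminant `x₀ x₂ - x₁²` of an integer point, viewed as a symmetric `2 × 2` matrix. -/
def disc (p : ℤ × ℤ × ℤ) : ℤ := p.1 * p.2.2 - p.2.1 ^ 2

theorem abs_disc_le {ξ : ℝ} {p : ℤ × ℤ × ℤ} (hp : 1 ≤ |p.1|) (hL : approxErr ξ p ≤ 1) :
    |(disc p : ℝ)| ≤ (2 + 2 * |ξ|) * |(p.1 : ℝ)| * approxErr ξ p := by
  have h1 := abs_fst_mul_sub_le ξ p
  have h2 := abs_fst_mul_sq_sub_le ξ p
  have hp' : (1 : ℝ) ≤ |(p.1 : ℝ)| := by exact_mod_cast hp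
  have e : (disc p : ℝ) = (p.1 * ξ - p.2.1) * (2 * (p.1 * ξ) - (p.1 * ξ - p.2.1))
      - p.1 * (p.1 * ξ ^ 2 - p.2.2) := by
    simp only [disc]; push_cast; ring
  rw [e]
  have h3 : |2 * (p.1 * ξ) - (p.1 * ξ - p.2.1)| ≤ 2 * (|(p.1 : ℝ)| * |ξ|) + |(p.1 : ℝ)| := by
    refine (abs_sub _ _).trans ?_
    rw [abs_mul, abs_mul, abs_two]
    linarith
  calc _ ≤ |p.1 * ξ - p.2.1| * |2 * (p.1 * ξ) - (p.1 * ξ - p.2.1)|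
        + |(p.1 : ℝ)| * |p.1 * ξ ^ 2 - p.2.2| := by
        rw [← abs_mul, ← abs_mul]; exact abs_sub _ _
    _ ≤ approxErr ξ p * (2 * (|(p.1 : ℝ)| * |ξ|) + |(p.1 : ℝ)|)
        + |(p.1 : ℝ)| * approxErr ξ p := by
        have := approxErr_nonneg ξ p
        gcongr
    _ = _ := by ring

/-- A point of discriminant zero is a multiple `k (m², m n, n²)` of a Veronese point. -/
theorem exists_eq_of_disc_eq_zero {p : ℤ × ℤ × ℤ} (hp : p.1 ≠ 0) (h : disc p = 0) :
    ∃ k m n : ℤ, p.1 = k * m ^ 2 ∧ p.2.1 = k * m * n ∧ p.2.2 = k * n ^ 2 := by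
  obtain ⟨g, m, n, hg, hco, hm, hn⟩ := Int.exists_gcd_one' (m := p.1) (n := p.2.1)
    (Int.gcd_pos_of_ne_zero_left _ hp)
  have hg0 : (g : ℤ) ≠ 0 := by exact_mod_cast hg.ne'
  have hm0 : m ≠ 0 := by rintro rfl; simp at hm; exact hp hm
  have e : m * p.2.2 = n ^ 2 * g := by
    apply mul_right_cancel₀ hg0
    simp only [disc] at h
    rw [hm, hn] at h
    linear_combination h
  have hdvd : m ∣ (g : ℤ) := by
    have : m ∣ n ^ 2 * g := ⟨_, e.symm⟩
    exact (Int.isCoprime_iff_gcd_eq_one.2 hco).pow_right.dvd_of_dvd_mul_left this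
  obtain ⟨k, hk⟩ := hdvd
  refine ⟨k, m, n, ?_, ?_, ?_⟩
  · rw [hm, hk]; ring
  · rw [hn, hk]; ring
  · apply mul_left_cancel₀ hm0
    rw [e, hk]; ring

open Real in
/-- A minimal point of discriminant zero would be so close to a multiple of a smaller point
`(m², m n, n²)` that the preceding minimal point would be proportional to it. -/
theorem disc_ne_zero {ξ c : ℝ} {p q r : ℤ × ℤ × ℤ} (hpq : IsNextMinimal ξ p q)
    (hqr : IsNextMinimal ξ q r) (hp : p.1 ≠ 0)
    (hLp : approxErr ξ p ≤ c * |(q.1 : ℝ)| ^ (-goldenRatio⁻¹))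
    (hLq : approxErr ξ q ≤ c * |(r.1 : ℝ)| ^ (-goldenRatio⁻¹))
    (hlarge : (1 + |ξ|) * (2 * c * |(q.1 : ℝ)| ^ (1 / 2 - goldenRatio⁻¹)) < 1) :
    disc q ≠ 0 := by
  intro h0
  have hpq' : |(p.1 : ℝ)| < |(q.1 : ℝ)| := by exact_mod_cast hpq.fst_lt
  have hqr' : |(q.1 : ℝ)| < |(r.1 : ℝ)| := by exact_mod_cast hqr.fst_lt
  have hp1 : (1 : ℝ) ≤ |(p.1 : ℝ)| := by exact_mod_cast Int.one_le_abs hp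
  have hq0 : q.1 ≠ 0 := by
    intro h; rw [h] at hpq'; simp at hpq'; linarith
  obtain ⟨k, m, n, e0, e1, e2⟩ := exists_eq_of_disc_eq_zero hq0 h0
  set X := |(q.1 : ℝ)| with hX
  have hX0 : 0 < X := by linarith
  have hk0 : k ≠ 0 := by rintro rfl; simp at e0; exact hq0 e0
  have hm0 : m ≠ 0 := by rintro rfl; simp at e0; exact hq0 e0
  have hk1 : (1 : ℝ) ≤ |(k : ℝ)| := by exact_mod_cast Int.one_le_abs hk0
  have hXe : X = |(k : ℝ)| * |(m : ℝ)| ^ 2 := by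
    rw [hX, e0]; push_cast; rw [abs_mul, abs_pow]
  have hm1 : |(m : ℝ)| ≤ √X := by
    apply Real.le_sqrt_of_sq_le
    rw [hXe]; nlinarith [sq_nonneg |(m : ℝ)|]
  have hkm : √X ≤ |(k : ℝ)| * |(m : ℝ)| := by
    apply Real.sqrt_le_iff.2 ⟨by positivity, ?_⟩
    rw [hXe, mul_pow]
    nlinarith [mul_nonneg (sq_nonneg |(m : ℝ)|) (sub_nonneg.2 hk1)]
  have hmn : √X * |m * ξ - n| ≤ approxErr ξ q := by
    calc _ ≤ |(k : ℝ)| * |(m : ℝ)| * |m * ξ - n| := by gcongr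
      _ = |(q.1 : ℝ) * ξ - q.2.1| := by
        rw [← abs_mul, ← abs_mul, e0, e1]; push_cast; congr 1; ring
      _ ≤ _ := abs_fst_mul_sub_le ξ q
  have hsq : 0 < √X := Real.sqrt_pos.2 hX0
  have hc : 0 ≤ c := by
    by_contra hc
    have : c * |(r.1 : ℝ)| ^ (-goldenRatio⁻¹) ≤ 0 :=
      mul_nonpos_of_nonpos_of_nonneg (not_le.1 hc).le (by positivity)
    have h1 : approxErr ξ q ≤ 0 := by linarith
    have h2 : approxErr ξ r < 0 := hqr.err_lt.trans_le h1
    exact (approxErr_nonneg ξ r).not_gt h2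
  have ha := inv_goldenRatio_pos
  have hsX : √X * X ^ (-goldenRatio⁻¹) = X ^ (1 / 2 - goldenRatio⁻¹) := by
    rw [Real.sqrt_eq_rpow, ← Real.rpow_add hX0]; congr 1
  have hLq' : approxErr ξ q ≤ c * X ^ (-goldenRatio⁻¹) := by
    refine hLq.trans (mul_le_mul_of_nonneg_left ?_ hc)
    exact Real.rpow_le_rpow_of_nonpos hX0 hqr'.le (by linarith)
  have hmn' : X * |m * ξ - n| ≤ c * X ^ (1 / 2 - goldenRatio⁻¹) := by
    calc _ = √X * (√X * |m * ξ - n|) := by rw [← mul_assoc, Real.mul_self_sqrt hX0.le]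
      _ ≤ √X * (c * X ^ (-goldenRatio⁻¹)) := mul_le_mul_of_nonneg_left (hmn.trans hLq') hsq.le
      _ = _ := by rw [← hsX]; ring
  have hmL : |(m : ℝ)| * approxErr ξ p ≤ c * X ^ (1 / 2 - goldenRatio⁻¹) := by
    calc _ ≤ √X * (c * X ^ (-goldenRatio⁻¹)) := by
          have := approxErr_nonneg ξ p
          gcongr
      _ = _ := by rw [← hsX]; ring
  -- `2 E` bounds the two minors below, up to the factor `1 + |ξ|`
  set E := c * X ^ (1 / 2 - goldenRatio⁻¹) with hE
  have hE0 : 0 ≤ E := by positivity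
  have hp1' := abs_fst_mul_sub_le ξ p
  have hp2' := abs_fst_mul_sq_sub_le ξ p
  have hLp1 := hpq.left.approxErr_le_one
  have small : ∀ t : ℤ, |(t : ℝ)| ≤ (1 + |ξ|) * (2 * E) → t = 0 := by
    intro t ht
    have : |(t : ℝ)| < 1 := by
      refine ht.trans_lt (lt_of_eq_of_lt ?_ hlarge)
      rw [hE]; ring
    exact Int.abs_lt_one_iff.1 (by exact_mod_cast this)
  have z1 : m * p.2.1 - n * p.1 = 0 := by
    apply small
    have e : ((m * p.2.1 - n * p.1 : ℤ) : ℝ) = p.1 * (m * ξ - n) - m * (p.1 * ξ - p.2.1) := by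
      push_cast; ring
    rw [e]
    calc _ ≤ |(p.1 : ℝ)| * |m * ξ - n| + |(m : ℝ)| * |p.1 * ξ - p.2.1| := by
          rw [← abs_mul, ← abs_mul]; exact abs_sub _ _
      _ ≤ X * |m * ξ - n| + |(m : ℝ)| * approxErr ξ p := by gcongr
      _ ≤ 1 * (2 * E) := by linarith
      _ ≤ _ := by gcongr; linarith [abs_nonneg ξ]
  have z2 : m * p.2.2 - n * p.2.1 = 0 := by
    apply small
    have e : ((m * p.2.2 - n * p.2.1 : ℤ) : ℝ) = p.2.1 * (m * ξ - n)
        + m * (ξ * (p.1 * ξ - p.2.1) - (p.1 * ξ ^ 2 - p.2.2)) := by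
      push_cast; ring
    rw [e]
    have b1 : |(p.2.1 : ℝ)| ≤ (1 + |ξ|) * X := by
      have : (p.2.1 : ℝ) = p.1 * ξ - (p.1 * ξ - p.2.1) := by ring
      rw [this]
      refine (abs_sub _ _).trans ?_
      rw [abs_mul]
      have : |(p.1 : ℝ)| * |ξ| ≤ X * |ξ| := by gcongr
      linarith
    have b2 : |ξ * (p.1 * ξ - p.2.1) - (p.1 * ξ ^ 2 - p.2.2)| ≤ (1 + |ξ|) * approxErr ξ p := by
      refine (abs_sub _ _).trans ?_
      rw [abs_mul]
      have : |ξ| * |p.1 * ξ - p.2.1| ≤ |ξ| * approxErr ξ p := by gcongr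
      linarith
    calc _ ≤ |(p.2.1 : ℝ)| * |m * ξ - n|
          + |(m : ℝ)| * |ξ * (p.1 * ξ - p.2.1) - (p.1 * ξ ^ 2 - p.2.2)| := by
          rw [← abs_mul, ← abs_mul]; exact abs_add_le _ _
      _ ≤ (1 + |ξ|) * X * |m * ξ - n| + |(m : ℝ)| * ((1 + |ξ|) * approxErr ξ p) := by gcongr
      _ = (1 + |ξ|) * (X * |m * ξ - n| + |(m : ℝ)| * approxErr ξ p) := by ring
      _ ≤ _ := by gcongr; linarith
  rcases hpq.minor_ne_zero hp with h | h
  · apply h; rw [e0, e1]; linear_combination -k * m * z1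
  · apply h; rw [e0, e2]; linear_combination -k * m * z2 - k * n * z1

/-! ### The sequence of minimal points -/

/-- A sequence of consecutive minimal points of an extremal number, together with the estimates
which a common constant `c` provides. -/
structure IsMinimalSequence (ξ c : ℝ) (x : ℕ → ℤ × ℤ × ℤ) : Prop where
  one_le : 1 ≤ c
  next : ∀ i, IsNextMinimal ξ (x i) (x (i + 1))
  le_fst : ∀ i : ℕ, (i : ℝ) + 1 ≤ |((x i).1 : ℝ)|
  err_le : ∀ i, approxErr ξ (x i) ≤ c * |((x (i + 1)).1 : ℝ)| ^ (-Real.goldenRatio⁻¹)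
  growth : ∀ i, |((x (i + 1)).1 : ℝ)| ^ Real.goldenRatio⁻¹ ≤ c * |((x i).1 : ℝ)|

open Real Filter Topology in
theorem IsExtremal.exists_isMinimalSequence {ξ : ℝ} (hξ : IsExtremal ξ) :
    ∃ c x, IsMinimalSequence ξ c x := by
  obtain ⟨hirr, -, c, hc, hext⟩ := hξ
  have ha := inv_goldenRatio_pos
  have ha1 := inv_goldenRatio_lt_one
  have hext' : ∀ X : ℝ, 1 ≤ X → ∃ z : ℤ × ℤ × ℤ, z ≠ 0 ∧ |(z.1 : ℝ)| ≤ X ∧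
      approxErr ξ z ≤ c * X ^ (-goldenRatio⁻¹) := by
    intro X hX
    obtain ⟨x0, x1, x2, hne, h0, h1, h2⟩ := hext X hX
    have e : -1 / goldenRatio = -goldenRatio⁻¹ := by rw [neg_div, one_div]
    rw [e] at h1 h2
    exact ⟨(x0, x1, x2), hne, h0, max_le h1 h2⟩
  have hstep : ∀ p, IsMinimalPoint ξ p → ∃ q, IsNextMinimal ξ p q := by
    intro p hp
    refine hp.exists_next ?_
    have hlim : Tendsto (fun X : ℝ => c * X ^ (-goldenRatio⁻¹)) atTop (𝓝 0) := by
      simpa using (tendsto_rpow_neg_atTop ha).const_mul c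
    obtain ⟨X, hX, hX1⟩ := ((hlim.eventually_lt_const (approxErr_pos hirr hp.1)).and
      (eventually_ge_atTop 1)).exists
    obtain ⟨z, hz, -, hz'⟩ := hext' X hX1
    exact ⟨z, hz, hz'.trans_lt hX⟩
  choose! f hf using hstep
  set x : ℕ → ℤ × ℤ × ℤ := fun i => f^[i] (0, 1, 0) with hx
  have hxs : ∀ i, x (i + 1) = f (x i) := fun i => Function.iterate_succ_apply' f i _
  have hmin : ∀ i, IsMinimalPoint ξ (x i) := by
    intro i
    induction i with
    | zero => exact isMinimalPoint_start ξ
    | succ i ih => rw [hxs]; exact (hf _ ih).right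
  have hnext : ∀ i, IsNextMinimal ξ (x i) (x (i + 1)) := fun i => by
    rw [hxs]; exact hf _ (hmin i)
  have hge : ∀ i : ℕ, (i : ℤ) ≤ |(x i).1| := by
    intro i
    induction i with
    | zero => simp
    | succ i ih => have := (hnext i).fst_lt; push_cast; omega
  have herr : ∀ i, 1 ≤ i →
      approxErr ξ (x i) ≤ 2 * c * |((x (i + 1)).1 : ℝ)| ^ (-goldenRatio⁻¹) := by
    intro i hi
    have h2 : (2 : ℝ) ≤ |((x (i + 1)).1 : ℝ)| := by
      have := hge (i + 1)
      have h : (2 : ℤ) ≤ |(x (i + 1)).1| := by push_cast at this; omega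
      exact_mod_cast h
    set X := |((x (i + 1)).1 : ℝ)| with hX
    obtain ⟨z, hz, hz1, hz2⟩ := hext' (X / 2) (by linarith)
    have hlt : |z.1| < |(x (i + 1)).1| := by
      have : |(z.1 : ℝ)| < |((x (i + 1)).1 : ℝ)| := by linarith
      exact_mod_cast this
    refine ((hnext i).le_err z hz hlt).trans (hz2.trans ?_)
    rw [Real.div_rpow (by linarith) (by norm_num), Real.rpow_neg (by norm_num : (0:ℝ) ≤ 2),
      div_inv_eq_mul]
    have : (2 : ℝ) ^ goldenRatio⁻¹ ≤ 2 := by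
      calc (2 : ℝ) ^ goldenRatio⁻¹ ≤ 2 ^ (1 : ℝ) :=
            Real.rpow_le_rpow_of_exponent_le (by norm_num) ha1.le
        _ = 2 := by simp
    calc _ ≤ c * (X ^ (-goldenRatio⁻¹) * 2) := by gcongr
      _ = _ := by ring
  have hlim : Tendsto (fun i : ℕ => (1 + |ξ|) * (2 * (2 * c) *
      |((x (i + 1)).1 : ℝ)| ^ (1 / 2 - goldenRatio⁻¹))) atTop (𝓝 0) := by
    have h1 : Tendsto (fun i : ℕ => |((x (i + 1)).1 : ℝ)|) atTop atTop := by
      refine tendsto_atTop_mono (fun i => ?_) tendsto_natCast_atTop_atTop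
      have := hge (i + 1)
      have h : (i : ℤ) ≤ |(x (i + 1)).1| := by push_cast at this; omega
      exact_mod_cast h
    have h2 := (tendsto_rpow_neg_atTop (sub_pos.2 half_lt_inv_goldenRatio)).comp h1
    have h3 := (h2.const_mul (2 * (2 * c))).const_mul (1 + |ξ|)
    simpa [Function.comp_def] using h3
  obtain ⟨N, hN'⟩ := eventually_atTop.1
    ((hlim.eventually_lt_const one_pos).and (eventually_ge_atTop 1))
  have hN1 : 1 ≤ N := (hN' N le_rfl).2
  have hN := fun i hi => (hN' i hi).1
  have hdisc : ∀ i, N ≤ i → disc (x (i + 1)) ≠ 0 := by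
    intro i hi
    refine disc_ne_zero (hnext i) (hnext (i + 1)) ?_ (herr i (by omega)) (herr (i + 1) (by omega))
      (hN i hi)
    have := hge i
    intro h
    rw [h] at this
    simp at this
    omega
  have hgrow : ∀ i, N ≤ i → |((x (i + 2)).1 : ℝ)| ^ goldenRatio⁻¹ ≤
      (2 + 2 * |ξ|) * (2 * c) * |((x (i + 1)).1 : ℝ)| := by
    intro i hi
    have h1 : (1 : ℝ) ≤ |(disc (x (i + 1)) : ℝ)| := by
      exact_mod_cast Int.one_le_abs (hdisc i hi)
    have h2 : 1 ≤ |(x (i + 1)).1| := by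
      have := hge (i + 1)
      push_cast at this; omega
    have h3 := abs_disc_le h2 (hmin (i + 1)).approxErr_le_one
    have h4 := herr (i + 1) (by omega)
    have hpos : 0 < |((x (i + 2)).1 : ℝ)| := by
      have := hge (i + 2)
      have h : 0 < |(x (i + 2)).1| := by push_cast at this; omega
      exact_mod_cast h
    have h5 : 1 ≤ (2 + 2 * |ξ|) * |((x (i + 1)).1 : ℝ)| *
        (2 * c * |((x (i + 2)).1 : ℝ)| ^ (-goldenRatio⁻¹)) :=
      h1.trans (h3.trans (by gcongr))
    rw [Real.rpow_neg hpos.le] at h5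
    have h6 : 0 < |((x (i + 2)).1 : ℝ)| ^ goldenRatio⁻¹ := by positivity
    calc _ = |((x (i + 2)).1 : ℝ)| ^ goldenRatio⁻¹ * 1 := by ring
      _ ≤ |((x (i + 2)).1 : ℝ)| ^ goldenRatio⁻¹ * _ := mul_le_mul_of_nonneg_left h5 h6.le
      _ = _ := by field_simp
  set K := 1 + 2 * c + (2 + 2 * |ξ|) * (2 * c) with hK
  have hK2 : 0 ≤ (2 + 2 * |ξ|) * (2 * c) := by positivity
  refine ⟨K, fun i => x (i + (N + 1)), by linarith, fun i => ?_, fun i => ?_, fun i => ?_,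
    fun i => ?_⟩
  · rw [show i + 1 + (N + 1) = i + (N + 1) + 1 by ring]
    exact hnext _
  · have := hge (i + (N + 1))
    have h : (i : ℤ) + 1 ≤ |(x (i + (N + 1))).1| := by push_cast at this; omega
    exact_mod_cast h
  · rw [show i + 1 + (N + 1) = i + (N + 1) + 1 by ring]
    refine (herr _ (by omega)).trans ?_
    gcongr
    linarith
  · rw [show i + 1 + (N + 1) = i + N + 2 by ring, show i + (N + 1) = i + N + 1 by ring]
    refine (hgrow (i + N) (by omega)).trans ?_
    gcongr
    linarith

open Real in
theorem le_of_rpow_inv_goldenRatio_le {u v K : ℝ} (hu : 0 ≤ u) (hv : 0 ≤ v) (hK : 0 ≤ K)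
    (h : u ^ goldenRatio⁻¹ ≤ K * v ^ goldenRatio⁻¹) : u ≤ K ^ goldenRatio * v := by
  have h1 := Real.rpow_le_rpow (by positivity) h goldenRatio_pos.le
  rwa [Real.mul_rpow hK (by positivity), ← Real.rpow_mul hu, ← Real.rpow_mul hv,
    inv_mul_cancel₀ goldenRatio_ne_zero, Real.rpow_one, Real.rpow_one] at h1

open Real in
theorem rpow_one_sub_inv_goldenRatio {u : ℝ} (hu : 0 ≤ u) :
    u ^ (1 - goldenRatio⁻¹) = (u ^ goldenRatio⁻¹) ^ goldenRatio⁻¹ := by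
  rw [← Real.rpow_mul hu, ← inv_goldenRatio_sq, pow_two]

open Real in
theorem mul_rpow_neg_inv_goldenRatio {u : ℝ} (hu : 0 < u) :
    u * u ^ (-goldenRatio⁻¹) = u ^ (1 - goldenRatio⁻¹) := by
  rw [sub_eq_add_neg, Real.rpow_add hu, Real.rpow_one]

/-! ### Changes of plane in the sequence of minimal points -/

theorem abs_minor_le (ξ : ℝ) (p q : ℤ × ℤ × ℤ) :
    |((p.1 * q.2.1 - p.2.1 * q.1 : ℤ) : ℝ)| ≤
        |(q.1 : ℝ)| * approxErr ξ p + |(p.1 : ℝ)| * approxErr ξ q ∧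
      |((p.1 * q.2.2 - p.2.2 * q.1 : ℤ) : ℝ)| ≤
        |(q.1 : ℝ)| * approxErr ξ p + |(p.1 : ℝ)| * approxErr ξ q := by
  constructor
  · have e : ((p.1 * q.2.1 - p.2.1 * q.1 : ℤ) : ℝ) =
        q.1 * (p.1 * ξ - p.2.1) - p.1 * (q.1 * ξ - q.2.1) := by push_cast; ring
    rw [e]
    refine (abs_sub _ _).trans ?_
    rw [abs_mul, abs_mul]
    gcongr
    · exact abs_fst_mul_sub_le ξ p
    · exact abs_fst_mul_sub_le ξ q
  · have e : ((p.1 * q.2.2 - p.2.2 * q.1 : ℤ) : ℝ) =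
        q.1 * (p.1 * ξ ^ 2 - p.2.2) - p.1 * (q.1 * ξ ^ 2 - q.2.2) := by push_cast; ring
    rw [e]
    refine (abs_sub _ _).trans ?_
    rw [abs_mul, abs_mul]
    gcongr
    · exact abs_fst_mul_sq_sub_le ξ p
    · exact abs_fst_mul_sq_sub_le ξ q

/-- The area spanned by `p` and `q` controls its dominant term `|q.1| * approxErr ξ p`, up to the
smaller term. -/
theorem mul_approxErr_le_of_minor_le {ξ B : ℝ} {p q : ℤ × ℤ × ℤ}
    (h1 : |((p.1 * q.2.1 - p.2.1 * q.1 : ℤ) : ℝ)| ≤ B)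
    (h2 : |((p.1 * q.2.2 - p.2.2 * q.1 : ℤ) : ℝ)| ≤ B) :
    |(q.1 : ℝ)| * approxErr ξ p ≤ B + |(p.1 : ℝ)| * approxErr ξ q := by
  rw [approxErr, mul_max_of_nonneg _ _ (abs_nonneg _)]
  refine max_le ?_ ?_
  · rw [← abs_mul]
    have e : (q.1 : ℝ) * (p.1 * ξ - p.2.1) =
        ((p.1 * q.2.1 - p.2.1 * q.1 : ℤ) : ℝ) + p.1 * (q.1 * ξ - q.2.1) := by push_cast; ring
    rw [e]
    refine (abs_add_le _ _).trans ?_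
    rw [abs_mul (p.1 : ℝ)]
    gcongr
    exact abs_fst_mul_sub_le ξ q
  · rw [← abs_mul]
    have e : (q.1 : ℝ) * (p.1 * ξ ^ 2 - p.2.2) =
        ((p.1 * q.2.2 - p.2.2 * q.1 : ℤ) : ℝ) + p.1 * (q.1 * ξ ^ 2 - q.2.2) := by push_cast; ring
    rw [e]
    refine (abs_add_le _ _).trans ?_
    rw [abs_mul (p.1 : ℝ)]
    gcongr
    exact abs_fst_mul_sq_sub_le ξ q

namespace IsMinimalSequence

variable {ξ c : ℝ} {x : ℕ → ℤ × ℤ × ℤ}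

theorem one_le_fst (h : IsMinimalSequence ξ c x) (i : ℕ) : 1 ≤ |((x i).1 : ℝ)| := by
  have := h.le_fst i
  have : (0 : ℝ) ≤ i := by positivity
  linarith

theorem fst_ne_zero (h : IsMinimalSequence ξ c x) (i : ℕ) : (x i).1 ≠ 0 := by
  intro h0
  have := h.one_le_fst i
  rw [h0] at this
  simp at this
  linarith

theorem strictMono (h : IsMinimalSequence ξ c x) : StrictMono fun i => |((x i).1 : ℝ)| :=
  strictMono_nat_of_lt_succ fun i => by exact_mod_cast (h.next i).fst_lt

theorem strictAnti (h : IsMinimalSequence ξ c x) : StrictAnti fun i => approxErr ξ (x i) :=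
  strictAnti_nat_of_succ_lt fun i => (h.next i).err_lt

/-- As long as three consecutive points remain dependent, all of them lie in the lattice
generated by the first two. -/
theorem exists_eq_combination_first (h : IsMinimalSequence ξ c x) {s t : ℕ}
    (hz : ∀ m, s ≤ m → m < t → det3 (x m) (x (m + 1)) (x (m + 2)) = 0) {m : ℕ} (hs : s ≤ m)
    (ht : m ≤ t + 1) : ∃ a b : ℤ, x m = a • x s + b • x (s + 1) := by
  obtain ⟨k, rfl⟩ := Nat.exists_eq_add_of_le hs
  induction k using Nat.strong_induction_on with
  | _ k ih =>
    match k with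
    | 0 => exact ⟨1, 0, by simp⟩
    | 1 => exact ⟨0, 1, by simp⟩
    | k + 2 =>
      obtain ⟨a, b, hab⟩ := ih k (by omega) (by omega) (by omega)
      obtain ⟨a', b', hab'⟩ := ih (k + 1) (by omega) (by omega) (by omega)
      have hd : det3 (x (s + (k + 2))) (x (s + k)) (x (s + k + 1)) = 0 := by
        rw [← hz (s + k) (by omega) (by omega)]
        simp only [det3, add_assoc]
        ring
      obtain ⟨u, v, huv⟩ := (h.next (s + k)).exists_eq_combination (h.fst_ne_zero _) hd
      refine ⟨u * a + v * a', u * b + v * b', ?_⟩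
      rw [huv, hab, show s + k + 1 = s + (k + 1) by ring, hab']
      module

/-- As long as three consecutive points remain dependent, all of them lie in the lattice
generated by the last two. -/
theorem exists_eq_combination_last (h : IsMinimalSequence ξ c x) {s t : ℕ}
    (hz : ∀ m, s ≤ m → m < t → det3 (x m) (x (m + 1)) (x (m + 2)) = 0) {m : ℕ} (hs : s ≤ m)
    (ht : m ≤ t + 1) : ∃ a b : ℤ, x m = a • x t + b • x (t + 1) := by
  obtain ⟨k, hk⟩ := Nat.exists_eq_add_of_le ht
  induction k using Nat.strong_induction_on generalizing m with
  | _ k ih =>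
    match k with
    | 0 => exact ⟨0, 1, by rw [hk]; simp⟩
    | 1 => exact ⟨1, 0, by rw [show m = t by omega]; simp⟩
    | k + 2 =>
      obtain ⟨a, b, hab⟩ := @ih k (by omega) (m + 2) (by omega) (by omega) (by omega)
      obtain ⟨a', b', hab'⟩ := @ih (k + 1) (by omega) (m + 1) (by omega) (by omega) (by omega)
      obtain ⟨u, v, huv⟩ := (h.next (m + 1)).exists_eq_combination (h.fst_ne_zero _)
        (hz m hs (by omega))
      refine ⟨u * a' + v * a, u * b' + v * b, ?_⟩
      rw [huv, hab', show m + 1 + 1 = m + 2 by ring, hab]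
      module

/-- Since `1, ξ, ξ²` are linearly independent over `ℚ`, no plane contains all the minimal points
from some index on. -/
theorem exists_det3_ne_zero (h : IsMinimalSequence ξ c x) (hirr : Irrational ξ)
    (hquad : ¬ IsQuadraticIrrational ξ) (s : ℕ) :
    ∃ i, s ≤ i ∧ det3 (x i) (x (i + 1)) (x (i + 2)) ≠ 0 := by
  by_contra! hz
  set p := x s with hp
  set q := x (s + 1) with hq
  -- the normal vector of the plane that would contain all later points
  set n0 : ℤ := p.2.1 * q.2.2 - p.2.2 * q.2.1 with hn0
  set n1 : ℤ := p.2.2 * q.1 - p.1 * q.2.2 with hn1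
  set n2 : ℤ := p.1 * q.2.1 - p.2.1 * q.1 with hn2
  have hne : (n0, n1, n2) ≠ 0 := by
    intro h0
    simp only [Prod.mk_eq_zero] at h0
    rcases (h.next s).minor_ne_zero (h.fst_ne_zero s) with hm | hm
    · exact hm h0.2.2
    · apply hm; rw [← hp, ← hq]; linarith [h0.2.1]
  refine hquad (isQuadraticIrrational_of_relation hirr hne ?_)
  by_contra hθ
  set θ : ℝ := n0 + n1 * ξ + n2 * ξ ^ 2 with hθ'
  have hθ0 : 0 < |θ| := abs_pos.2 hθ
  have key : ∀ i : ℕ, (i : ℝ) * |θ| ≤ |(n1 : ℝ)| + |(n2 : ℝ)| := by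
    intro i
    obtain ⟨a, b, hab⟩ := h.exists_eq_combination_first (s := s) (t := s + i)
      (fun m hm _ => hz m hm) (m := s + i) (by omega) (by omega)
    have horth : n0 * (x (s + i)).1 + n1 * (x (s + i)).2.1 + n2 * (x (s + i)).2.2 = 0 := by
      rw [hab, ← hp, ← hq]
      simp only [Prod.fst_add, Prod.smul_fst, smul_eq_mul, Prod.snd_add, Prod.smul_snd, hn0, hn1,
        hn2]
      ring
    have hL := (h.next (s + i)).left.approxErr_le_one
    have hX := h.le_fst (s + i)
    set z := x (s + i)
    have horth' : (n0 : ℝ) * z.1 + n1 * z.2.1 + n2 * z.2.2 = 0 := by exact_mod_cast horth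
    have e : (z.1 : ℝ) * θ = n1 * (z.1 * ξ - z.2.1) + n2 * (z.1 * ξ ^ 2 - z.2.2) := by
      rw [hθ']; linear_combination horth'
    have hi : (i : ℝ) ≤ |(z.1 : ℝ)| := by
      push_cast at hX
      have : (0 : ℝ) ≤ s := by positivity
      linarith
    calc (i : ℝ) * |θ| ≤ |(z.1 : ℝ)| * |θ| := by gcongr
      _ = |n1 * (z.1 * ξ - z.2.1) + n2 * (z.1 * ξ ^ 2 - z.2.2)| := by rw [← abs_mul, e]
      _ ≤ |(n1 : ℝ)| * |z.1 * ξ - z.2.1| + |(n2 : ℝ)| * |z.1 * ξ ^ 2 - z.2.2| := by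
        rw [← abs_mul, ← abs_mul]; exact abs_add_le _ _
      _ ≤ |(n1 : ℝ)| * 1 + |(n2 : ℝ)| * 1 := by
        gcongr
        · exact (abs_fst_mul_sub_le ξ z).trans hL
        · exact (abs_fst_mul_sq_sub_le ξ z).trans hL
      _ = _ := by ring
  obtain ⟨i, hi⟩ := exists_nat_gt ((|(n1 : ℝ)| + |(n2 : ℝ)|) / |θ|)
  rw [div_lt_iff₀ hθ0] at hi
  exact (key i).not_gt hi

open Real

/-- At three independent consecutive points, the determinant bounds below the product of the two
larger errors. -/
theorem one_le_of_det3_ne_zero (h : IsMinimalSequence ξ c x) {i : ℕ}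
    (hi : det3 (x i) (x (i + 1)) (x (i + 2)) ≠ 0) :
    1 ≤ 6 * |((x (i + 2)).1 : ℝ)| * approxErr ξ (x i) * approxErr ξ (x (i + 1)) := by
  have h1 : (1 : ℝ) ≤ |(det3 (x i) (x (i + 1)) (x (i + 2)) : ℝ)| := by
    exact_mod_cast Int.one_le_abs hi
  refine h1.trans (abs_det3_le_of_le ?_ ?_ ?_ ?_)
  · exact_mod_cast h.strictMono.monotone (by omega : i ≤ i + 2)
  · exact_mod_cast h.strictMono.monotone (by omega : i + 1 ≤ i + 2)
  · exact h.strictAnti.antitone (by omega : i ≤ i + 2)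
  · exact h.strictAnti.antitone (by omega : i + 1 ≤ i + 2)

theorem fst_le_of_det3_ne_zero (h : IsMinimalSequence ξ c x) {i : ℕ}
    (hi : det3 (x i) (x (i + 1)) (x (i + 2)) ≠ 0) :
    |((x (i + 1)).1 : ℝ)| ≤
      (6 * c ^ 2) ^ goldenRatio * |((x (i + 2)).1 : ℝ)| ^ goldenRatio⁻¹ := by
  have h0 := h.one_le_of_det3_ne_zero hi
  have hc := h.one_le
  have hL0 := h.err_le i
  have hL1 := h.err_le (i + 1)
  have n0 := approxErr_nonneg ξ (x i)
  have n1 := approxErr_nonneg ξ (x (i + 1))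
  have hX : 0 < |((x (i + 1)).1 : ℝ)| := by linarith [h.one_le_fst (i + 1)]
  have hY : 0 < |((x (i + 2)).1 : ℝ)| := by linarith [h.one_le_fst (i + 2)]
  rw [show i + 1 + 1 = i + 2 by ring] at hL1
  set X := |((x (i + 1)).1 : ℝ)|
  set Y := |((x (i + 2)).1 : ℝ)|
  apply le_of_rpow_inv_goldenRatio_le hX.le (by positivity) (by positivity)
  rw [← rpow_one_sub_inv_goldenRatio hY.le, ← mul_rpow_neg_inv_goldenRatio hY]
  have h2 : 1 ≤ 6 * Y * (c * X ^ (-goldenRatio⁻¹)) * (c * Y ^ (-goldenRatio⁻¹)) :=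
    h0.trans (by gcongr)
  have hXa : 0 < X ^ goldenRatio⁻¹ := by positivity
  rw [Real.rpow_neg hX.le] at h2
  calc X ^ goldenRatio⁻¹ = X ^ goldenRatio⁻¹ * 1 := by ring
    _ ≤ X ^ goldenRatio⁻¹ * _ := mul_le_mul_of_nonneg_left h2 hXa.le
    _ = _ := by field_simp

theorem fst_mul_err_le_of_det3_ne_zero (h : IsMinimalSequence ξ c x) {i : ℕ}
    (hi : det3 (x i) (x (i + 1)) (x (i + 2)) ≠ 0) :
    |((x (i + 1)).1 : ℝ)| * approxErr ξ (x (i + 1)) ≤ c * (6 * c ^ 2) ^ goldenRatio := by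
  have hc := h.one_le
  have hL1 := h.err_le (i + 1)
  have hY : 0 < |((x (i + 2)).1 : ℝ)| := by linarith [h.one_le_fst (i + 2)]
  rw [show i + 1 + 1 = i + 2 by ring] at hL1
  calc _ ≤ (6 * c ^ 2) ^ goldenRatio * |((x (i + 2)).1 : ℝ)| ^ goldenRatio⁻¹ *
        (c * |((x (i + 2)).1 : ℝ)| ^ (-goldenRatio⁻¹)) :=
        mul_le_mul (h.fst_le_of_det3_ne_zero hi) hL1 (approxErr_nonneg _ _) (by positivity)
    _ = _ := by
        rw [Real.rpow_neg hY.le]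
        field_simp

theorem le_fst_mul_err_of_det3_ne_zero (h : IsMinimalSequence ξ c x) {i : ℕ}
    (hi : det3 (x i) (x (i + 1)) (x (i + 2)) ≠ 0) :
    |((x (i + 1)).1 : ℝ)| ^ (1 - goldenRatio⁻¹) ≤
      6 * c ^ 2 * (|((x (i + 1)).1 : ℝ)| * approxErr ξ (x i)) := by
  have h0 := h.one_le_of_det3_ne_zero hi
  have hc := h.one_le
  have hL1 := h.err_le (i + 1)
  have hg := h.growth (i + 1)
  have n0 := approxErr_nonneg ξ (x i)
  have hX : 0 < |((x (i + 1)).1 : ℝ)| := by linarith [h.one_le_fst (i + 1)]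
  have hY : 0 < |((x (i + 2)).1 : ℝ)| := by linarith [h.one_le_fst (i + 2)]
  rw [show i + 1 + 1 = i + 2 by ring] at hL1 hg
  set X := |((x (i + 1)).1 : ℝ)|
  set Y := |((x (i + 2)).1 : ℝ)|
  have ha := inv_goldenRatio_pos
  have hca : c ^ goldenRatio⁻¹ ≤ c := by
    calc _ ≤ c ^ (1 : ℝ) := Real.rpow_le_rpow_of_exponent_le hc inv_goldenRatio_lt_one.le
      _ = c := Real.rpow_one c
  have h2 : 1 ≤ 6 * c ^ 2 * (X ^ goldenRatio⁻¹ * approxErr ξ (x i)) := by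
    calc 1 ≤ 6 * Y * approxErr ξ (x i) * (c * Y ^ (-goldenRatio⁻¹)) := h0.trans (by gcongr)
      _ = 6 * c * (Y ^ goldenRatio⁻¹) ^ goldenRatio⁻¹ * approxErr ξ (x i) := by
        rw [← rpow_one_sub_inv_goldenRatio hY.le, ← mul_rpow_neg_inv_goldenRatio hY]; ring
      _ ≤ 6 * c * (c * X) ^ goldenRatio⁻¹ * approxErr ξ (x i) := by gcongr
      _ = 6 * c * (c ^ goldenRatio⁻¹ * X ^ goldenRatio⁻¹) * approxErr ξ (x i) := by
        rw [Real.mul_rpow (by linarith) hX.le]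
      _ ≤ 6 * c * (c * X ^ goldenRatio⁻¹) * approxErr ξ (x i) := by gcongr
      _ = _ := by ring
  have hXX : X ^ (1 - goldenRatio⁻¹) * X ^ goldenRatio⁻¹ = X := by
    rw [← Real.rpow_add hX]; simp
  calc X ^ (1 - goldenRatio⁻¹) = X ^ (1 - goldenRatio⁻¹) * 1 := by ring
    _ ≤ X ^ (1 - goldenRatio⁻¹) * (6 * c ^ 2 * (X ^ goldenRatio⁻¹ * approxErr ξ (x i))) := by
      gcongr
    _ = 6 * c ^ 2 * (X ^ (1 - goldenRatio⁻¹) * X ^ goldenRatio⁻¹ * approxErr ξ (x i)) := by ring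
    _ = _ := by rw [hXX]

/-- Between two consecutive changes of plane, the area of the fundamental parallelogram of the
common lattice is seen both from its first and from its last two points; hence the first
coordinates grow only by a bounded factor from `x (i + 2)` to `x (j + 1)`. Together with the growth
estimate for `x (i + 1)` and `x (i + 2)` this bounds `x (j + 1)` in terms of `x (i + 1)`. -/
theorem rpow_fst_le_of_consecutive (h : IsMinimalSequence ξ c x) {i j : ℕ} (hij : i < j)
    (hj : det3 (x j) (x (j + 1)) (x (j + 2)) ≠ 0)
    (hz : ∀ m, i < m → m < j → det3 (x m) (x (m + 1)) (x (m + 2)) = 0) :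
    |((x (j + 1)).1 : ℝ)| ^ goldenRatio⁻¹ ≤
      (6 * c ^ 2 * (2 * c + c * (6 * c ^ 2) ^ goldenRatio)) ^ goldenRatio * c *
        |((x (i + 1)).1 : ℝ)| := by
  have hc := h.one_le
  have ha := inv_goldenRatio_pos
  obtain ⟨a, b, hab⟩ := h.exists_eq_combination_last (s := i + 1) (t := j) (m := i + 1)
    (fun m h1 h2 => hz m h1 h2) le_rfl (by omega)
  obtain ⟨a', b', hab'⟩ := h.exists_eq_combination_last (s := i + 1) (t := j) (m := i + 2)
    (fun m h1 h2 => hz m h1 h2) (by omega) (by omega)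
  have hg := h.growth (i + 1)
  have hL := h.err_le (i + 1)
  have hl := h.le_fst_mul_err_of_det3_ne_zero hj
  have hu := h.fst_mul_err_le_of_det3_ne_zero hj
  rw [show i + 1 + 1 = i + 2 by ring] at hg hL
  have hminor := abs_minor_le ξ (x (i + 1)) (x (i + 2))
  have hindep := (h.next (i + 1)).minor_ne_zero (h.fst_ne_zero _)
  rw [show i + 1 + 1 = i + 2 by ring] at hindep
  have hX1 := h.one_le_fst (i + 1)
  have hX2 := h.one_le_fst (i + 2)
  have hX3 := h.one_le_fst (j + 1)
  have hmono : |((x (i + 1)).1 : ℝ)| ≤ |((x (i + 2)).1 : ℝ)| :=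
    h.strictMono.monotone (by omega : i + 1 ≤ i + 2)
  have hmono' : |((x j).1 : ℝ)| ≤ |((x (j + 1)).1 : ℝ)| :=
    h.strictMono.monotone (by omega : j ≤ j + 1)
  have hanti : approxErr ξ (x (i + 2)) ≤ approxErr ξ (x (i + 1)) :=
    h.strictAnti.antitone (by omega : i + 1 ≤ i + 2)
  have e1 : (x (i + 1)).1 * (x (i + 2)).2.1 - (x (i + 1)).2.1 * (x (i + 2)).1 =
      (a * b' - b * a') * ((x j).1 * (x (j + 1)).2.1 - (x j).2.1 * (x (j + 1)).1) := by
    rw [hab, hab']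
    simp only [Prod.fst_add, Prod.smul_fst, smul_eq_mul, Prod.snd_add, Prod.smul_snd]
    ring
  have e2 : (x (i + 1)).1 * (x (i + 2)).2.2 - (x (i + 1)).2.2 * (x (i + 2)).1 =
      (a * b' - b * a') * ((x j).1 * (x (j + 1)).2.2 - (x j).2.2 * (x (j + 1)).1) := by
    rw [hab, hab']
    simp only [Prod.fst_add, Prod.smul_fst, smul_eq_mul, Prod.snd_add, Prod.smul_snd]
    ring
  rw [e1, e2] at hindep hminor
  have hdet : a * b' - b * a' ≠ 0 := by
    intro h0
    simp [h0] at hindep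
  have hdet1 : (1 : ℝ) ≤ |((a * b' - b * a' : ℤ) : ℝ)| := by exact_mod_cast Int.one_le_abs hdet
  have hle : ∀ t : ℤ, |(t : ℝ)| ≤ |(((a * b' - b * a') * t : ℤ) : ℝ)| := by
    intro t
    rw [Int.cast_mul, abs_mul]
    exact le_mul_of_one_le_left (abs_nonneg _) hdet1
  have hmain := mul_approxErr_le_of_minor_le (ξ := ξ) ((hle _).trans hminor.1)
    ((hle _).trans hminor.2)
  set X := |((x (i + 1)).1 : ℝ)|
  set Y := |((x (i + 2)).1 : ℝ)|
  set Z := |((x (j + 1)).1 : ℝ)|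
  set D := c * (6 * c ^ 2) ^ goldenRatio with hD
  have hD0 : 0 ≤ D := by positivity
  have hY1 : 1 ≤ Y ^ (1 - goldenRatio⁻¹) :=
    Real.one_le_rpow hX2 (by linarith [inv_goldenRatio_lt_one])
  have n1 := approxErr_nonneg ξ (x (i + 1))
  have n2 := approxErr_nonneg ξ (x (j + 1))
  have n3 := approxErr_nonneg ξ (x (i + 2))
  have h5 : Z * approxErr ξ (x j) ≤ (2 * c + D) * Y ^ (1 - goldenRatio⁻¹) := by
    calc _ ≤ Y * approxErr ξ (x (i + 1)) + X * approxErr ξ (x (i + 2))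
          + |((x j).1 : ℝ)| * approxErr ξ (x (j + 1)) := hmain
      _ ≤ Y * approxErr ξ (x (i + 1)) + Y * approxErr ξ (x (i + 1))
          + Z * approxErr ξ (x (j + 1)) := by gcongr
      _ ≤ Y * (c * Y ^ (-goldenRatio⁻¹)) + Y * (c * Y ^ (-goldenRatio⁻¹))
          + D * Y ^ (1 - goldenRatio⁻¹) := by
          exact add_le_add (by gcongr) (hu.trans (le_mul_of_one_le_right hD0 hY1))
      _ = _ := by
          rw [← mul_rpow_neg_inv_goldenRatio (by linarith : 0 < Y)]; ring
  have hZ0 : 0 ≤ Z ^ goldenRatio⁻¹ := by positivity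
  rw [mul_assoc]
  apply le_of_rpow_inv_goldenRatio_le hZ0 (by positivity) (by positivity)
  rw [← rpow_one_sub_inv_goldenRatio (by positivity : 0 ≤ Z)]
  calc _ ≤ 6 * c ^ 2 * (Z * approxErr ξ (x j)) := hl
    _ ≤ 6 * c ^ 2 * ((2 * c + D) * Y ^ (1 - goldenRatio⁻¹)) := by gcongr
    _ = 6 * c ^ 2 * (2 * c + D) * (Y ^ goldenRatio⁻¹) ^ goldenRatio⁻¹ := by
      rw [rpow_one_sub_inv_goldenRatio (by positivity : 0 ≤ Y)]; ring
    _ ≤ _ := by gcongr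

/-- The middle points of three consecutive changes of plane are linearly independent. -/
theorem det3_ne_zero_of_consecutive (h : IsMinimalSequence ξ c x) {i j l : ℕ} (hij : i < j)
    (hjl : j < l) (hj : det3 (x j) (x (j + 1)) (x (j + 2)) ≠ 0)
    (hz : ∀ m, i < m → m < j → det3 (x m) (x (m + 1)) (x (m + 2)) = 0)
    (hz' : ∀ m, j < m → m < l → det3 (x m) (x (m + 1)) (x (m + 2)) = 0) :
    det3 (x (i + 1)) (x (j + 1)) (x (l + 1)) ≠ 0 := by
  obtain ⟨a, b, hab⟩ := h.exists_eq_combination_last (s := i + 1) (t := j) (m := i + 1)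
    (fun m h1 h2 => hz m h1 h2) le_rfl (by omega)
  obtain ⟨e, f, hef⟩ := h.exists_eq_combination_first (s := j + 1) (t := l) (m := l + 1)
    (fun m h1 h2 => hz' m h1 h2) (by omega) (by omega)
  rw [show j + 1 + 1 = j + 2 by ring] at hef
  have ha : a ≠ 0 := by
    rintro rfl
    rw [zero_smul, zero_add] at hab
    have h1 : |((x (i + 1)).1 : ℝ)| < |((x (j + 1)).1 : ℝ)| := h.strictMono (by omega)
    have h2 := h.one_le_fst (i + 1)
    have h3 : |((x (i + 1)).1 : ℝ)| = |(b : ℝ)| * |((x (j + 1)).1 : ℝ)| := by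
      rw [hab, ← abs_mul]; simp
    rcases eq_or_ne b 0 with rfl | hb
    · simp at h3; rw [h3] at h2; simp at h2; linarith
    · have : (1 : ℝ) ≤ |(b : ℝ)| := by exact_mod_cast Int.one_le_abs hb
      nlinarith
  have hf : f ≠ 0 := by
    rintro rfl
    rw [zero_smul, add_zero] at hef
    have h1 : approxErr ξ (x (l + 1)) < approxErr ξ (x (j + 1)) := h.strictAnti (by omega)
    have h2 := h.one_le_fst (l + 1)
    have h3 : approxErr ξ (x (l + 1)) = |(e : ℝ)| * approxErr ξ (x (j + 1)) := by
      rw [hef, approxErr_smul]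
    have h4 := approxErr_nonneg ξ (x (j + 1))
    rcases eq_or_ne e 0 with rfl | he
    · rw [hef] at h2; simp at h2; linarith
    · have : (1 : ℝ) ≤ |(e : ℝ)| := by exact_mod_cast Int.one_le_abs he
      nlinarith
  have key : det3 (x (i + 1)) (x (j + 1)) (x (l + 1)) =
      a * f * det3 (x j) (x (j + 1)) (x (j + 2)) := by
    rw [hab, hef]
    simp only [det3, Prod.fst_add, Prod.smul_fst, smul_eq_mul, Prod.snd_add, Prod.smul_snd]
    ring
  rw [key]
  exact mul_ne_zero (mul_ne_zero ha hf) hj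

end IsMinimalSequence

/-! ### The sequence of extremal points -/

open Real in
/-- A sequence of integer points whose sizes grow like iterated `γ`-th powers, whose errors are
comparable to the inverses of their sizes, and of which any three consecutive ones are linearly
independent. The estimates share a constant `C`. -/
structure IsExtremalSequence (ξ C : ℝ) (y : ℕ → ℤ × ℤ × ℤ) : Prop where
  one_le : 1 ≤ C
  le_fst : ∀ k : ℕ, (k : ℝ) + 1 ≤ |((y k).1 : ℝ)|
  monotone : Monotone fun k => |((y k).1 : ℝ)|
  antitone : Antitone fun k => approxErr ξ (y k)
  err_le : ∀ k, |((y k).1 : ℝ)| * approxErr ξ (y k) ≤ C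
  rpow_le : ∀ k, |((y (k + 1)).1 : ℝ)| ^ goldenRatio⁻¹ ≤ C * |((y k).1 : ℝ)|
  le_rpow : ∀ k, |((y k).1 : ℝ)| ≤ C * |((y (k + 1)).1 : ℝ)| ^ goldenRatio⁻¹
  det3_ne_zero : ∀ k, det3 (y k) (y (k + 1)) (y (k + 2)) ≠ 0

open Real in
theorem IsExtremal.exists_isExtremalSequence {ξ : ℝ} (hξ : IsExtremal ξ) :
    ∃ C y, IsExtremalSequence ξ C y := by
  obtain ⟨c, x, h⟩ := hξ.exists_isMinimalSequence
  have hc := h.one_le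
  -- from each index, the next one at which the plane changes
  have hnext : ∀ i, ∃ j, i < j ∧ det3 (x j) (x (j + 1)) (x (j + 2)) ≠ 0 ∧
      ∀ m, i < m → m < j → det3 (x m) (x (m + 1)) (x (m + 2)) = 0 := by
    intro i
    classical
    have hex : ∃ j, i + 1 ≤ j ∧ det3 (x j) (x (j + 1)) (x (j + 2)) ≠ 0 :=
      h.exists_det3_ne_zero hξ.1 hξ.2.1 (i + 1)
    refine ⟨Nat.find hex, (Nat.find_spec hex).1, (Nat.find_spec hex).2, fun m h1 h2 => ?_⟩
    by_contra h3
    exact Nat.find_min hex h2 ⟨h1, h3⟩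
  choose f hlt hne hzero using hnext
  set n : ℕ → ℕ := fun k => f^[k + 1] 0 with hn
  have hns : ∀ k, n (k + 1) = f (n k) := fun k => Function.iterate_succ_apply' f (k + 1) 0
  have hturn : ∀ k, det3 (x (n k)) (x (n k + 1)) (x (n k + 2)) ≠ 0 := by
    intro k
    have : n k = f (f^[k] 0) := Function.iterate_succ_apply' f k 0
    rw [this]; exact hne _
  have hmono : StrictMono n := strictMono_nat_of_lt_succ fun k => by rw [hns]; exact hlt _
  set K1 := c * (6 * c ^ 2) ^ goldenRatio
  set K2 := (6 * c ^ 2 * (2 * c + K1)) ^ goldenRatio * c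
  set K3 := (6 * c ^ 2) ^ goldenRatio
  have h1 : 0 ≤ K1 := by positivity
  have h2 : 0 ≤ K2 := by positivity
  have h3 : 0 ≤ K3 := by positivity
  refine ⟨1 + K1 + K2 + K3, fun k => x (n k + 1), by linarith, fun k => ?_, ?_, ?_, fun k => ?_,
    fun k => ?_, fun k => ?_, fun k => ?_⟩
  · have := h.le_fst (n k + 1)
    have h4 : (k : ℝ) ≤ n k := by exact_mod_cast hmono.id_le k
    push_cast at this
    linarith
  · exact fun k l hkl => h.strictMono.monotone (Nat.add_le_add_right (hmono.monotone hkl) 1)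
  · exact fun k l hkl => h.strictAnti.antitone (Nat.add_le_add_right (hmono.monotone hkl) 1)
  · exact (h.fst_mul_err_le_of_det3_ne_zero (hturn k)).trans (by linarith)
  · have := h.rpow_fst_le_of_consecutive (hlt (n k)) (hne _) (hzero (n k))
    rw [← hns] at this
    refine this.trans ?_
    gcongr
    linarith
  · refine (h.fst_le_of_det3_ne_zero (hturn k)).trans ?_
    have : |((x (n k + 2)).1 : ℝ)| ≤ |((x (n (k + 1) + 1)).1 : ℝ)| :=
      h.strictMono.monotone (by have := hmono (Nat.lt_succ_self k); simp at this; omega)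
    have ha := inv_goldenRatio_pos
    gcongr
    linarith
  · have := h.det3_ne_zero_of_consecutive (hlt (n k)) (hlt (f (n k))) (hne _) (hzero _) (hzero _)
    simpa only [hns] using this

/-! ### Multiplying the determinant by an irrational number -/

theorem exists_pos_le_abs_mul_sub {ξ : ℝ} (hξ : Irrational ξ) (N : ℝ) :
    ∃ δ : ℝ, 0 < δ ∧ ∀ d : ℤ, d ≠ 0 → |(d : ℝ)| ≤ N → ∀ n : ℤ, δ ≤ |n - d * ξ| := by
  set S : Finset ℤ := (Finset.Icc (-max 1 ⌈N⌉) (max 1 ⌈N⌉)).erase 0 with hS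
  have hne : S.Nonempty := ⟨1, by simp [hS]; linarith [le_max_left 1 ⌈N⌉]⟩
  obtain ⟨e, he, hmin⟩ := S.exists_min_image (fun d : ℤ => |d * ξ - round (d * ξ)|) hne
  refine ⟨|e * ξ - round (e * ξ)|, abs_pos.2 (sub_ne_zero.2 ?_), fun d hd hdN n => ?_⟩
  · exact (hξ.intCast_mul (Finset.ne_of_mem_erase he)).ne_int _
  · rw [abs_sub_comm (n : ℝ)]
    refine (hmin d ?_).trans (round_le _ _)
    refine Finset.mem_erase.2 ⟨hd, Finset.mem_Icc.2 (abs_le.1 ?_)⟩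
    have h1 : |(d : ℝ)| ≤ (⌈N⌉ : ℝ) := hdN.trans (Int.le_ceil N)
    have h2 : |d| ≤ ⌈N⌉ := by exact_mod_cast h1
    exact h2.trans (le_max_right _ _)

namespace IsExtremalSequence

open Real

variable {ξ C : ℝ} {y : ℕ → ℤ × ℤ × ℤ}

theorem one_le_fst (h : IsExtremalSequence ξ C y) (k : ℕ) : 1 ≤ |((y k).1 : ℝ)| := by
  have := h.le_fst k
  have : (0 : ℝ) ≤ k := by positivity
  linarith

theorem rpow_const_le (h : IsExtremalSequence ξ C y) : C ^ goldenRatio⁻¹ ≤ C := by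
  calc _ ≤ C ^ (1 : ℝ) :=
        Real.rpow_le_rpow_of_exponent_le h.one_le inv_goldenRatio_lt_one.le
    _ = C := Real.rpow_one C

theorem rpow_one_sub_le (h : IsExtremalSequence ξ C y) (k : ℕ) :
    |((y (k + 2)).1 : ℝ)| ^ (1 - goldenRatio⁻¹) ≤ C ^ 2 * |((y k).1 : ℝ)| := by
  have hC := h.one_le
  have ha := inv_goldenRatio_pos
  calc _ = (|((y (k + 2)).1 : ℝ)| ^ goldenRatio⁻¹) ^ goldenRatio⁻¹ :=
        rpow_one_sub_inv_goldenRatio (abs_nonneg _)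
    _ ≤ (C * |((y (k + 1)).1 : ℝ)|) ^ goldenRatio⁻¹ := by
        gcongr
        exact h.rpow_le (k + 1)
    _ = C ^ goldenRatio⁻¹ * |((y (k + 1)).1 : ℝ)| ^ goldenRatio⁻¹ :=
        Real.mul_rpow (by linarith) (abs_nonneg _)
    _ ≤ C * (C * |((y k).1 : ℝ)|) := by
        gcongr
        · exact h.rpow_const_le
        · exact h.rpow_le k
    _ = _ := by ring

theorem fst_le_mul (h : IsExtremalSequence ξ C y) (k : ℕ) :
    |((y (k + 2)).1 : ℝ)| ≤ C ^ 3 * (|((y k).1 : ℝ)| * |((y (k + 1)).1 : ℝ)|) := by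
  have hC := h.one_le
  have hW : 0 < |((y (k + 2)).1 : ℝ)| := by linarith [h.one_le_fst (k + 2)]
  calc |((y (k + 2)).1 : ℝ)| =
        |((y (k + 2)).1 : ℝ)| ^ goldenRatio⁻¹ * |((y (k + 2)).1 : ℝ)| ^ (1 - goldenRatio⁻¹) := by
        rw [← Real.rpow_add hW]; simp
    _ ≤ C * |((y (k + 1)).1 : ℝ)| * (C ^ 2 * |((y k).1 : ℝ)|) := by
        gcongr
        · exact h.rpow_le (k + 1)
        · exact h.rpow_one_sub_le k
    _ = _ := by ring

theorem mul_le_fst (h : IsExtremalSequence ξ C y) (k : ℕ) :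
    |((y k).1 : ℝ)| * |((y (k + 1)).1 : ℝ)| ≤ C ^ 3 * |((y (k + 2)).1 : ℝ)| := by
  have hC := h.one_le
  have ha := inv_goldenRatio_pos
  have hW : 0 < |((y (k + 2)).1 : ℝ)| := by linarith [h.one_le_fst (k + 2)]
  have h1 : |((y k).1 : ℝ)| ≤ C ^ 2 * |((y (k + 2)).1 : ℝ)| ^ (1 - goldenRatio⁻¹) := by
    calc _ ≤ C * |((y (k + 1)).1 : ℝ)| ^ goldenRatio⁻¹ := h.le_rpow k
      _ ≤ C * (C * |((y (k + 2)).1 : ℝ)| ^ goldenRatio⁻¹) ^ goldenRatio⁻¹ := by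
          gcongr
          exact h.le_rpow (k + 1)
      _ = C * (C ^ goldenRatio⁻¹ * |((y (k + 2)).1 : ℝ)| ^ (1 - goldenRatio⁻¹)) := by
          rw [Real.mul_rpow (by linarith) (by positivity),
            rpow_one_sub_inv_goldenRatio (abs_nonneg _)]
      _ ≤ C * (C * |((y (k + 2)).1 : ℝ)| ^ (1 - goldenRatio⁻¹)) := by
          gcongr
          exact h.rpow_const_le
      _ = _ := by ring
  calc _ ≤ C ^ 2 * |((y (k + 2)).1 : ℝ)| ^ (1 - goldenRatio⁻¹) *
        (C * |((y (k + 2)).1 : ℝ)| ^ goldenRatio⁻¹) := by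
        gcongr
        exact h.le_rpow (k + 1)
    _ = C ^ 3 * (|((y (k + 2)).1 : ℝ)| ^ (1 - goldenRatio⁻¹) *
        |((y (k + 2)).1 : ℝ)| ^ goldenRatio⁻¹) := by ring
    _ = _ := by rw [← Real.rpow_add hW]; simp

theorem abs_det3_le (h : IsExtremalSequence ξ C y) (k : ℕ) :
    |(det3 (y k) (y (k + 1)) (y (k + 2)) : ℝ)| ≤ 6 * C ^ 5 := by
  have hC := h.one_le
  have n0 := approxErr_nonneg ξ (y k)
  have n1 := approxErr_nonneg ξ (y (k + 1))
  calc _ ≤ 6 * |((y (k + 2)).1 : ℝ)| * approxErr ξ (y k) * approxErr ξ (y (k + 1)) := by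
        refine abs_det3_le_of_le ?_ ?_ ?_ ?_
        · have : |((y k).1 : ℝ)| ≤ |((y (k + 2)).1 : ℝ)| := h.monotone (by omega : k ≤ k + 2)
          exact_mod_cast this
        · have : |((y (k + 1)).1 : ℝ)| ≤ |((y (k + 2)).1 : ℝ)| :=
            h.monotone (by omega : k + 1 ≤ k + 2)
          exact_mod_cast this
        · exact h.antitone (by omega : k ≤ k + 2)
        · exact h.antitone (by omega : k + 1 ≤ k + 2)
    _ ≤ 6 * (C ^ 3 * (|((y k).1 : ℝ)| * |((y (k + 1)).1 : ℝ)|)) * approxErr ξ (y k) *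
          approxErr ξ (y (k + 1)) := by
        gcongr
        exact h.fst_le_mul k
    _ = 6 * C ^ 3 * ((|((y k).1 : ℝ)| * approxErr ξ (y k)) *
          (|((y (k + 1)).1 : ℝ)| * approxErr ξ (y (k + 1)))) := by ring
    _ ≤ 6 * C ^ 3 * (C * C) := by
        gcongr
        · exact h.err_le k
        · exact h.err_le (k + 1)
    _ = _ := by ring

/-- The last point `r = (r₀, r₁, r₂)` of three consecutive ones is replaced by
`s = (r₁, r₂, r₃)`, where `r₃ = -(u r₀ + v r₁ + w r₂)` is an integer close to `r₀ ξ³` if the monic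
cubic `T³ + w T² + v T + u` is small at `ξ`. This nearly multiplies the determinant by the
irrational number `ξ`, although the determinants before and after are integers. -/
theorem le_of_forall_le_abs_sub (h : IsExtremalSequence ξ C y) {δ : ℝ}
    (hδ : ∀ d : ℤ, d ≠ 0 → |(d : ℝ)| ≤ 6 * C ^ 5 → ∀ n : ℤ, δ ≤ |n - d * ξ|)
    {u v w : ℤ} {H : ℝ} (hH : 1 ≤ H) (hv : |(v : ℝ)| ≤ H) (hw : |(w : ℝ)| ≤ H) (k : ℕ) :
    δ ≤ 6 * C ^ 6 * (3 + 2 * |ξ| + |ξ| ^ 2) *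
      (|((y (k + 1)).1 : ℝ)| ^ 2 * |u + v * ξ + w * ξ ^ 2 + ξ ^ 3| +
        H / |((y k).1 : ℝ)| ^ 2) := by
  have hC := h.one_le
  have hX := h.one_le_fst k
  have hY := h.one_le_fst (k + 1)
  have hW := h.one_le_fst (k + 2)
  have hXY : |((y k).1 : ℝ)| ≤ |((y (k + 1)).1 : ℝ)| := h.monotone (by omega : k ≤ k + 1)
  have hLxy : approxErr ξ (y (k + 1)) ≤ approxErr ξ (y k) := h.antitone (by omega : k ≤ k + 1)
  have hLx := h.err_le k
  have hLy := h.err_le (k + 1)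
  have hLz := h.err_le (k + 2)
  have hup := h.fst_le_mul k
  have hlow := h.mul_le_fst k
  have hdist := hδ _ (h.det3_ne_zero k) (h.abs_det3_le k)
  set p := y k
  set q := y (k + 1)
  set r := y (k + 2)
  set s : ℤ × ℤ × ℤ := (r.2.1, r.2.2, -(u * r.1 + v * r.2.1 + w * r.2.2)) with hs
  have hdist' := hdist (det3 p q s)
  set X := |(p.1 : ℝ)|
  set Y := |(q.1 : ℝ)|
  set W := |(r.1 : ℝ)|
  set θ : ℝ := u + v * ξ + w * ξ ^ 2 + ξ ^ 3 with hθ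
  have r1 := abs_fst_mul_sub_le ξ r
  have r2 := abs_fst_mul_sq_sub_le ξ r
  have nx := approxErr_nonneg ξ p
  have ny := approxErr_nonneg ξ q
  have nr := approxErr_nonneg ξ r
  set L := approxErr ξ r
  set e1 : ℝ := r.1 * ξ - r.2.1 with he1
  set e2 : ℝ := r.1 * ξ ^ 2 - r.2.2 with he2
  set K := 3 + 2 * |ξ| + |ξ| ^ 2 with hK
  have hK1 : 1 ≤ K := by have := abs_nonneg ξ; have := sq_nonneg |ξ|; linarith
  set E := K * H * L + W * |θ| with hE
  have hWθ : 0 ≤ W * |θ| := by positivity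
  have hHL : L ≤ H * L := le_mul_of_one_le_left nr hH
  have hξL : 0 ≤ |ξ| * (H * L) := by positivity
  have hξL2 : 0 ≤ |ξ| ^ 2 * (H * L) := by positivity
  have hξ1 : |ξ| * L ≤ |ξ| * (H * L) := by gcongr
  have hξ2 : |ξ| ^ 2 * L ≤ |ξ| ^ 2 * (H * L) := by gcongr
  have hEe : E = 3 * (H * L) + 2 * (|ξ| * (H * L)) + |ξ| ^ 2 * (H * L) + W * |θ| := by
    rw [hE, hK]; ring
  -- the three coordinates of `s - ξ r`, the last two in the frame adapted to `(1, ξ, ξ²)`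
  have b0 : |-e1| ≤ E := by
    rw [abs_neg]
    linarith
  have b1 : |e2 - 2 * (ξ * e1)| ≤ E := by
    refine (abs_sub _ _).trans ?_
    rw [abs_mul, abs_mul, abs_two]
    have : |ξ| * |e1| ≤ |ξ| * L := by gcongr
    linarith
  have b2 : |r.1 * θ - ξ ^ 2 * e1 - ξ * e2 - v * e1 - w * e2| ≤ E := by
    have t1 : |ξ ^ 2 * e1| ≤ |ξ| ^ 2 * L := by rw [abs_mul, abs_pow]; gcongr
    have t2 : |ξ * e2| ≤ |ξ| * L := by rw [abs_mul]; gcongr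
    have t3 : |w * e2| ≤ H * L := by rw [abs_mul]; gcongr
    have t4 : |v * e1| ≤ H * L := by rw [abs_mul]; gcongr
    have t5 : |r.1 * θ| ≤ W * |θ| := by rw [abs_mul]
    calc _ ≤ |r.1 * θ| + |ξ ^ 2 * e1| + |ξ * e2| + |v * e1| + |w * e2| := by
          refine (abs_sub _ _).trans (add_le_add ?_ le_rfl)
          refine (abs_sub _ _).trans (add_le_add ?_ le_rfl)
          refine (abs_sub _ _).trans (add_le_add ?_ le_rfl)
          exact abs_sub _ _
      _ ≤ E := by linarith
  have hdet := abs_det_le (a0 := p.1) (b0 := q.1) le_rfl le_rfl b0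
    (abs_fst_mul_sub_le ξ p) (abs_fst_mul_sq_sub_le ξ p) (abs_fst_mul_sub_le ξ q)
    (abs_fst_mul_sq_sub_le ξ q) b1 b2
  have hE0 : 0 ≤ E := (abs_nonneg _).trans b0
  have hLyY : approxErr ξ q ≤ C * Y := by
    calc approxErr ξ q ≤ Y * approxErr ξ q := le_mul_of_one_le_left ny hY
      _ ≤ C := hLy
      _ ≤ C * Y := le_mul_of_one_le_right (by linarith) hY
  have hbound : δ ≤ 6 * C * (Y * approxErr ξ p) * E := by
    calc δ ≤ _ := hdist'
      _ ≤ 2 * (X * (approxErr ξ q * E) + Y * (approxErr ξ p * E)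
          + E * (approxErr ξ p * approxErr ξ q)) := by
          refine le_trans (le_of_eq ?_) hdet
          congr 1
          simp only [det3, hs, hθ, he1, he2]
          push_cast
          ring
      _ ≤ 2 * (Y * (approxErr ξ p * E) + Y * (approxErr ξ p * E)
          + E * (approxErr ξ p * (C * Y))) := by gcongr
      _ = 2 * (2 + C) * (Y * approxErr ξ p) * E := by ring
      _ ≤ _ := by
          have : 2 * (2 + C) ≤ 6 * C := by linarith
          gcongr
  have hX0 : 0 < X := by linarith
  have hW0 : 0 < W := by linarith
  have hLx' : approxErr ξ p ≤ C / X := by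
    rw [le_div_iff₀ hX0, mul_comm]; exact hLx
  have hLz' : L ≤ C / W := by
    rw [le_div_iff₀ hW0, mul_comm]; exact hLz
  have hYX : Y / (X * W) ≤ C ^ 3 / X ^ 2 := by
    rw [div_le_div_iff₀ (by positivity) (by positivity)]
    calc Y * X ^ 2 = X * (X * Y) := by ring
      _ ≤ X * (C ^ 3 * W) := by gcongr
      _ = _ := by ring
  have hYW : Y * W / X ≤ C ^ 3 * Y ^ 2 := by
    rw [div_le_iff₀ hX0]
    calc Y * W ≤ Y * (C ^ 3 * (X * Y)) := by gcongr
      _ = _ := by ring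
  calc δ ≤ 6 * C * (Y * approxErr ξ p) * E := hbound
    _ ≤ 6 * C * (Y * (C / X)) * (K * H * (C / W) + W * |θ|) := by
        rw [hE]; gcongr
    _ = 6 * C ^ 2 * (K * H * C * (Y / (X * W)) + |θ| * (Y * W / X)) := by
        field_simp
    _ ≤ 6 * C ^ 2 * (K * H * C * (C ^ 3 / X ^ 2) + |θ| * (C ^ 3 * Y ^ 2)) := by gcongr
    _ = 6 * C ^ 6 * K * (H / X ^ 2) + 6 * C ^ 5 * 1 * (|θ| * Y ^ 2) := by ring
    _ ≤ 6 * C ^ 6 * K * (H / X ^ 2) + 6 * C ^ 6 * K * (|θ| * Y ^ 2) := by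
        have : C ^ 5 ≤ C ^ 6 := pow_le_pow_right₀ hC (by norm_num)
        gcongr
    _ = _ := by ring

end IsExtremalSequence

/-! ### Values of monic cubic polynomials -/

open Real in
/-- A monic cubic integer polynomial cannot be small at an extremal number. -/
theorem IsExtremal.exists_le_abs_cubic {ξ : ℝ} (hξ : IsExtremal ξ) :
    ∃ c : ℝ, 0 < c ∧ ∀ (u v w : ℤ) (H : ℝ), 1 ≤ H → |(v : ℝ)| ≤ H → |(w : ℝ)| ≤ H →
      c * H ^ (-goldenRatio ^ 2) ≤ |u + v * ξ + w * ξ ^ 2 + ξ ^ 3| := by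
  obtain ⟨C, y, h⟩ := hξ.exists_isExtremalSequence
  obtain ⟨δ, hδ0, hδ⟩ := exists_pos_le_abs_mul_sub hξ.1 (6 * C ^ 5)
  have hC := h.one_le
  set K := 6 * C ^ 6 * (3 + 2 * |ξ| + |ξ| ^ 2) with hK
  have hK0 : 0 < K := by positivity
  set M := (C ^ 4 * (2 * K / δ)) ^ (goldenRatio ^ 2) with hM
  have hM0 : 0 ≤ M := by positivity
  have hy1 := h.one_le_fst 1
  set T := M + |((y 1).1 : ℝ)| ^ 2 with hT
  have hT0 : 0 < T := by positivity
  refine ⟨δ / (2 * K * T), by positivity, fun u v w H hH hv hw => ?_⟩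
  have hineq := h.le_of_forall_le_abs_sub hδ (u := u) hH hv hw
  rw [← hK] at hineq
  set θ := |u + v * ξ + w * ξ ^ 2 + ξ ^ 3|
  have hex : ∃ k, 2 * K * H ≤ δ * |((y k).1 : ℝ)| ^ 2 := by
    obtain ⟨k, hk⟩ := exists_nat_gt (2 * K * H / δ)
    refine ⟨k, ?_⟩
    rw [div_lt_iff₀ hδ0] at hk
    have h1 := h.le_fst k
    have h2 := h.one_le_fst k
    have h3 : (k : ℝ) ≤ |((y k).1 : ℝ)| ^ 2 := by nlinarith
    nlinarith
  classical
  have hk := Nat.find_spec hex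
  have hkmin := fun m => Nat.find_min hex (m := m)
  set k := Nat.find hex
  have hH1 : 1 ≤ H ^ (goldenRatio ^ 2) := Real.one_le_rpow hH (by positivity)
  -- the choice of `k` makes the first coordinate of the next point at most `√T H ^ (γ² / 2)`
  have hnext : |((y (k + 1)).1 : ℝ)| ^ 2 ≤ T * H ^ (goldenRatio ^ 2) := by
    rcases Nat.eq_zero_or_pos k with h0 | hpos
    · rw [h0, zero_add]
      calc |((y 1).1 : ℝ)| ^ 2 ≤ T := by linarith
        _ ≤ _ := le_mul_of_one_le_right hT0.le hH1
    · obtain ⟨j, hj⟩ := Nat.exists_eq_add_of_le' hpos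
      have hlt := not_le.1 (hkmin j (by omega))
      have hgrow := h.rpow_one_sub_le j
      rw [hj, show j + 1 + 1 = j + 2 by ring]
      set Z := |((y (j + 2)).1 : ℝ)|
      have e : (Z ^ 2) = ((Z ^ (1 - goldenRatio⁻¹)) ^ 2) ^ (goldenRatio ^ 2) := by
        rw [← Real.rpow_natCast (Z ^ (1 - goldenRatio⁻¹)), ← Real.rpow_mul (abs_nonneg _),
          ← Real.rpow_mul (abs_nonneg _), ← inv_goldenRatio_sq, ← Real.rpow_natCast]
        congr 1
        have := goldenRatio_ne_zero
        rw [inv_pow]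
        field_simp
      calc Z ^ 2 = ((Z ^ (1 - goldenRatio⁻¹)) ^ 2) ^ (goldenRatio ^ 2) := e
        _ ≤ ((C ^ 2 * |((y j).1 : ℝ)|) ^ 2) ^ (goldenRatio ^ 2) := by gcongr
        _ ≤ (C ^ 4 * (2 * K / δ) * H) ^ (goldenRatio ^ 2) := by
            have : |((y j).1 : ℝ)| ^ 2 ≤ 2 * K / δ * H := by
              rw [div_mul_eq_mul_div, le_div_iff₀ hδ0]; linarith
            have h4 : (C ^ 2 * |((y j).1 : ℝ)|) ^ 2 ≤ C ^ 4 * (2 * K / δ) * H := by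
              calc _ = C ^ 4 * |((y j).1 : ℝ)| ^ 2 := by ring
                _ ≤ C ^ 4 * (2 * K / δ * H) := by gcongr
                _ = _ := by ring
            gcongr
        _ = M * H ^ (goldenRatio ^ 2) := Real.mul_rpow (by positivity) (by linarith)
        _ ≤ _ := by
            gcongr
            have := sq_nonneg |((y 1).1 : ℝ)|
            linarith
  have hX0 : 0 < |((y k).1 : ℝ)| := by linarith [h.one_le_fst k]
  have hhalf : K * (H / |((y k).1 : ℝ)| ^ 2) ≤ δ / 2 := by
    rw [← mul_div_assoc, div_le_iff₀ (by positivity)]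
    linarith
  have hmain : δ / 2 ≤ K * (T * H ^ (goldenRatio ^ 2) * θ) := by
    have h1 := hineq k
    have h2 : K * (|((y (k + 1)).1 : ℝ)| ^ 2 * θ) ≤ K * (T * H ^ (goldenRatio ^ 2) * θ) := by
      have : 0 ≤ θ := abs_nonneg _
      gcongr
    rw [mul_add] at h1
    linarith
  have hH0 : 0 < H ^ (goldenRatio ^ 2) := by linarith
  rw [Real.rpow_neg (by linarith), ← div_eq_mul_inv, div_div, div_le_iff₀ (by positivity)]
  linarith

/-! ### Algebraic integers of degree at most three -/

open Polynomial in
/-- An algebraic integer of degree at most `3` is a root of a monic cubic integer polynomial whose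
coefficients are bounded by its height: multiply the minimal polynomial by a power of `T`. -/
theorem exists_monic_cubic {α : ℂ} (hα : IsIntegral ℤ α) (hd : (minpoly ℚ α).natDegree ≤ 3) :
    ∃ u v w : ℤ, |(v : ℝ)| ≤ algIntHeight α ∧ |(w : ℝ)| ≤ algIntHeight α ∧
      (u : ℂ) + v * α + w * α ^ 2 + α ^ 3 = 0 := by
  set Q := minpoly ℤ α with hQ
  have hQm : Q.Monic := minpoly.monic hα
  have hdeg : Q.natDegree ≤ 3 := by
    rw [minpoly.isIntegrallyClosed_eq_field_fractions' ℚ hα, hQm.natDegree_map] at hd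
    exact hd
  set P : ℤ[X] := X ^ (3 - Q.natDegree) * Q with hP
  have hPm : P.Monic := (monic_X_pow _).mul hQm
  have hPd : P.natDegree = 3 := by
    rw [hP, (monic_X_pow _).natDegree_mul hQm, natDegree_X_pow]; omega
  have hP0 : aeval α P = 0 := by rw [hP, map_mul, hQ, minpoly.aeval, mul_zero]
  have hcoeff : ∀ n, |((P.coeff n : ℤ) : ℝ)| ≤ algIntHeight α := by
    intro n
    rw [hP, coeff_X_pow_mul']
    split_ifs
    · exact Q.le_supNorm _
    · simpa [algIntHeight] using Q.supNorm_nonneg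
  refine ⟨P.coeff 0, P.coeff 1, P.coeff 2, hcoeff 1, hcoeff 2, ?_⟩
  rw [aeval_eq_sum_range' (by omega : P.natDegree < 4)] at hP0
  have h3 : P.coeff 3 = 1 := by rw [← hPd]; exact hPm
  simpa [Finset.sum_range_succ, h3] using hP0

theorem one_le_algIntHeight {α : ℂ} (hα : IsIntegral ℤ α) : 1 ≤ algIntHeight α := by
  have h := (minpoly ℤ α).le_supNorm (minpoly ℤ α).natDegree
  rw [Polynomial.coeff_natDegree, (minpoly.monic hα).leadingCoeff] at h
  simpa [algIntHeight] using h

/-- For every extremal real number `ξ` there is a constant `c > 0` such that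
`|ξ - α| ≥ c H(α) ^ (-γ² - 1)` for every algebraic integer `α ∈ ℂ` of degree at most `3`. -/
theorem theorem1p5 (ξ : ℝ) (hξ : IsExtremal ξ) :
    ∃ c : ℝ, 0 < c ∧ ∀ α : ℂ, IsIntegral ℤ α → (minpoly ℚ α).natDegree ≤ 3 →
      c * algIntHeight α ^ (-Real.goldenRatio ^ 2 - 1) ≤ ‖(ξ : ℂ) - α‖ := by
  obtain ⟨c, hc, hcubic⟩ := hξ.exists_le_abs_cubic
  set B := 1 + |ξ| with hB
  have hB1 : 1 ≤ B := by have := abs_nonneg ξ; linarith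
  set K := 1 + 2 * B + 3 * B ^ 2 with hK
  have hK0 : 0 < K := by positivity
  refine ⟨min 1 (c / K), by positivity, fun α hα hd => ?_⟩
  obtain ⟨u, v, w, hv, hw, hroot⟩ := exists_monic_cubic hα hd
  have hH := one_le_algIntHeight hα
  set H := algIntHeight α
  have hH0 : 0 < H := by linarith
  rcases le_or_gt 1 ‖(ξ : ℂ) - α‖ with hfar | hnear
  · refine le_trans ?_ hfar
    have h1 : H ^ (-Real.goldenRatio ^ 2 - 1) ≤ 1 :=
      Real.rpow_le_one_of_one_le_of_nonpos hH (by nlinarith [sq_nonneg Real.goldenRatio])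
    calc _ ≤ 1 * H ^ (-Real.goldenRatio ^ 2 - 1) := by
          gcongr
          exact min_le_left _ _
      _ ≤ 1 := by linarith
  · have hξB : ‖(ξ : ℂ)‖ ≤ B := by
      rw [Complex.norm_real, Real.norm_eq_abs]; linarith
    have hαB : ‖α‖ ≤ B := by
      have e : α = (ξ : ℂ) - (ξ - α) := by ring
      rw [e]
      refine (norm_sub_le _ _).trans ?_
      rw [Complex.norm_real, Real.norm_eq_abs]
      linarith
    have hle : |u + v * ξ + w * ξ ^ 2 + ξ ^ 3| ≤ ‖(ξ : ℂ) - α‖ * (K * H) := by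
      have e : ((u + v * ξ + w * ξ ^ 2 + ξ ^ 3 : ℝ) : ℂ) = (ξ - α) *
          (v + w * (ξ + α) + (ξ ^ 2 + ξ * α + α ^ 2)) := by
        push_cast
        linear_combination hroot
      rw [← Real.norm_eq_abs, ← Complex.norm_real, e, norm_mul]
      gcongr
      have hv' : ‖(v : ℂ)‖ ≤ H := by simpa using hv
      have hw' : ‖(w : ℂ)‖ ≤ H := by simpa using hw
      have s1 : ‖(ξ : ℂ) + α‖ ≤ 2 * B := (norm_add_le _ _).trans (by linarith)
      have s2 : ‖(ξ : ℂ) ^ 2 + ξ * α + α ^ 2‖ ≤ 3 * B ^ 2 := by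
        calc _ ≤ ‖(ξ : ℂ)‖ ^ 2 + ‖(ξ : ℂ)‖ * ‖α‖ + ‖α‖ ^ 2 := by
              rw [← norm_pow, ← norm_mul, ← norm_pow]
              exact (norm_add_le _ _).trans (by gcongr; exact norm_add_le _ _)
          _ ≤ B ^ 2 + B * B + B ^ 2 := by gcongr
          _ = _ := by ring
      calc _ ≤ ‖(v : ℂ)‖ + ‖(w : ℂ)‖ * ‖(ξ : ℂ) + α‖ + ‖(ξ : ℂ) ^ 2 + ξ * α + α ^ 2‖ := by
            rw [← norm_mul]
            exact (norm_add_le _ _).trans (by gcongr; exact norm_add_le _ _)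
        _ ≤ H + H * (2 * B) + 3 * B ^ 2 * H := by
            gcongr
            exact s2.trans (le_mul_of_one_le_right (by positivity) hH)
        _ = _ := by rw [hK]; ring
    have hmain := (hcubic u v w H hH hv hw).trans hle
    rw [Real.rpow_sub_one hH0.ne']
    calc _ ≤ c / K * (H ^ (-Real.goldenRatio ^ 2) / H) := by
          gcongr
          exact min_le_right _ _
      _ = c * H ^ (-Real.goldenRatio ^ 2) / (K * H) := by field_simp
      _ ≤ _ := by rw [div_le_iff₀ (by positivity)]; exact hmain
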